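/- Linear bandit and LinUCB on the unit ball. Let $d\ge 2$, $\theta^\star\in\mathbb R^d$ with $\|\theta^\star\|_2=1$, and a horizon $T\in\mathbb N$ be given. In round $t=1,\dots,T$ the learner plays an action $a_t$ in the closed unit ball $\mathcal B^d$ and observes $r_t=\langle a_t,\theta^\star\rangle+\epsilon_t$. With $\mathcal F_t=\sigma(a_1,r_1,\dots,a_t,r_t)$, the action $a_t$ is $\mathcal F_{t-1}$-measurable and the noise satisfies $\mathbb E[\epsilon_t\mid\mathcal F_{t-1}]=0$, $\mathrm{Var}[\epsilon_t\mid\mathcal F_{t-1}]=\sigma^2$ and $\mathbb E[e^{l\epsilon_t}\mid\mathcal F_{t-1}]\le e^{\sigma^2l^2/2}$ for all $l\in\mathbb R$, where $\sigma\ge 0$. Put $\Lambda_t=I_d+\sum_{s=1}^t a_sa_s^\top$ with eigenvalues $\lambda_{t,1}\ge\dots\ge\lambda_{t,d}$, let $\overline\theta_t=\Lambda_t^{-1}\sum_{s=1}^t r_sa_s$, and let $\widehat\theta_t=\overline\theta_t/\|\overline\theta_t\|_2$ (any vector of norm at most $1$ if $\overline\theta_t=0$). LinUCB with exploration parameter $\beta$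 plays $$a_t\in\arg\max_{a\in\mathcal B^d}\ \langle a,\widehat\theta_{t-1}\rangle+\beta\sqrt{a^\top\Lambda_{t-1}^{-1}a}.$$ Proposition 1. For every $\kappa>0$ there are constants $c,C>0$, depending only on $\kappa$, such that for all $d\ge2$ and all $\beta\ge\kappa$ there is a deterministic integer $t_1=t_1(\kappa,d,\beta)$ with $c\,\beta^2d\le t_1\le C\,\beta^2d$ such that for every $T$, $\sigma$, $\theta^\star$ and every run of LinUCB as above: (1) Surely, for all $0\le t\le\min(t_1,T)$, $$c\,\max\{1,t/d\}\ \le\ \lambda_{t,d}\ \le\ C\,\max\{1,t/d\};$$ in particular $\lambda_{t,d}\asymp t/d$ for $d\le t\le\min(t_1,T)$. (2) If $t_1\le T$ and $\beta\ge\kappa\,\sigma\sqrt{d+\log T}$, then with probability greater than $1-1/T$, $$\lambda_{t_1,1}-\lambda_{t_1,2}\ \ge\ c\,t_1 .$$ -/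

import Mathlib

open MeasureTheory ProbabilityTheory

noncomputable section

/-- Vectors of `ℝ^d` with the Euclidean norm. -/
abbrev Vec (d : ℕ) := EuclideanSpace ℝ (Fin d)

/-- The cumulative covariance matrix `Λ_t = I_d + ∑_{s=1}^t a_s a_sᵀ` of a sequence of actions
`a_1, a_2, …` (the value `a 0` is never used). -/
def designMatrix {d : ℕ} (a : ℕ → Vec d) (t : ℕ) : Matrix (Fin d) (Fin d) ℝ :=
  1 + ∑ s ∈ Finset.Icc 1 t, Matrix.vecMulVec (a s).ofLp (a s).ofLp

theorem designMatrix_posDef {d : ℕ} (a : ℕ → Vec d) (t : ℕ) : (designMatrix a t).PosDef := by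
  unfold designMatrix
  refine Matrix.PosDef.one.add_posSemidef (Matrix.posSemidef_sum _ fun s _ => ?_)
  simpa using Matrix.posSemidef_vecMulVec_self_star (a s).ofLp

/-- The eigenvalues of `Λ_t` in non-increasing order, counted with multiplicity: the index
`i = 0, …, d - 1` stands for the `(i+1)`-st largest eigenvalue. -/
def designEig {d : ℕ} (a : ℕ → Vec d) (t : ℕ) (i : Fin d) : ℝ :=
  (designMatrix_posDef a t).isHermitian.eigenvalues₀ (Fin.cast (Fintype.card_fin d).symm i)

/-- The ridge estimator `Λ_t⁻¹ ∑_{s=1}^t r_s a_s` based on the first `t` rounds. -/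
def ridge {d : ℕ} (a : ℕ → Vec d) (r : ℕ → ℝ) (t : ℕ) : Vec d :=
  WithLp.toLp 2 ((designMatrix a t)⁻¹.mulVec (∑ s ∈ Finset.Icc 1 t, r s • a s).ofLp)

/-- `y` is a projection of `x` onto the unit sphere: it is `x / ‖x‖` when `x ≠ 0`. The projection
of `0` (which occurs at least before the first round) may be any point of the unit ball, so that
every convention for it, a unit vector or `0`, is allowed. -/
def IsSphereProj {d : ℕ} (x y : Vec d) : Prop :=
  (x ≠ 0 → y = ‖x‖⁻¹ • x) ∧ ‖y‖ ≤ 1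

/-- The UCB score `⟨b, y⟩ + β √(bᵀ Λ⁻¹ b)` of the action `b`, for the estimate `y` of the
parameter. -/
def ucbScore {d : ℕ} (β : ℝ) (L : Matrix (Fin d) (Fin d) ℝ) (y b : Vec d) : ℝ :=
  inner ℝ b y + β * √(b.ofLp ⬝ᵥ (L⁻¹.mulVec b.ofLp))

/-- The `σ`-algebra generated by `a_1, r_1, …, a_t, r_t`. -/
@[reducible] def history {d : ℕ} {Ω : Type*} (a : ℕ → Ω → Vec d) (r : ℕ → Ω → ℝ) (t : ℕ) :
    MeasurableSpace Ω :=
  ⨆ s ∈ Finset.Icc 1 t,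
    (MeasurableSpace.comap (a s) inferInstance ⊔ MeasurableSpace.comap (r s) inferInstance)

/-- The noise `ε_t = r_t - ⟨a_t, θ⟩`, so that `r_t = ⟨a_t, θ⟩ + ε_t`. -/
def noise {d : ℕ} {Ω : Type*} (θ : Vec d) (a : ℕ → Ω → Vec d) (r : ℕ → Ω → ℝ) (t : ℕ) (ω : Ω) :
    ℝ :=
  r t ω - inner ℝ (a t ω) θ

/-- `(a_t, r_t)`, `t = 1, …, T`, are the actions and rewards of LinUCB with exploration
parameter `β` on the unit ball of `ℝ^d`, in the linear bandit with unit-norm parameter `θ` and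
conditionally sub-Gaussian noise with conditional variance `σ²`. -/
structure IsLinUCB {d : ℕ} {Ω : Type*} [MeasurableSpace Ω] (μ : Measure Ω) (T : ℕ) (β σ : ℝ)
    (θ : Vec d) (a : ℕ → Ω → Vec d) (r : ℕ → Ω → ℝ) : Prop where
  norm_theta : ‖θ‖ = 1
  sigma_nonneg : 0 ≤ σ
  measurable_reward : ∀ t, 1 ≤ t → t ≤ T → Measurable (r t)
  measurable_action : ∀ t, 1 ≤ t → t ≤ T → Measurable (a t)
  /-- The action of round `t` is a function of the past trajectory. -/
  predictable : ∀ t, 1 ≤ t → t ≤ T → Measurable[history a r (t - 1)] (a t)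
  /-- The action of round `t` lies in the unit ball. -/
  action_mem : ∀ t, 1 ≤ t → t ≤ T → ∀ ω, ‖a t ω‖ ≤ 1
  /-- The action of round `t` maximizes the UCB score over the unit ball. -/
  action_max : ∀ t, 1 ≤ t → t ≤ T → ∀ ω, ∃ y : Vec d,
    IsSphereProj (ridge (fun s => a s ω) (fun s => r s ω) (t - 1)) y ∧
    ∀ b : Vec d, ‖b‖ ≤ 1 →
      ucbScore β (designMatrix (fun s => a s ω) (t - 1)) y b ≤
        ucbScore β (designMatrix (fun s => a s ω) (t - 1)) y (a t ω)
  /-- All exponential moments of the noise are finite (so that the conditional expectations below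
  are genuine ones). -/
  noise_integrable : ∀ t, 1 ≤ t → t ≤ T → ∀ l : ℝ,
    Integrable (fun ω => Real.exp (l * noise θ a r t ω)) μ
  noise_mean : ∀ t, 1 ≤ t → t ≤ T →
    μ[noise θ a r t | history a r (t - 1)] =ᵐ[μ] fun _ => 0
  noise_var : ∀ t, 1 ≤ t → t ≤ T →
    Var[noise θ a r t; μ | history a r (t - 1)] =ᵐ[μ] fun _ => σ ^ 2
  noise_subgaussian : ∀ t, 1 ≤ t → t ≤ T → ∀ l : ℝ,
    μ[fun ω => Real.exp (l * noise θ a r t ω) | history a r (t - 1)] ≤ᵐ[μ]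
      fun _ => Real.exp (σ ^ 2 * l ^ 2 / 2)

end

noncomputable section

/-! ### The design matrix as an operator -/

variable {d : ℕ}

/-! The argument rests on a constant `R`, depending only on `κ`, and on the level `R β²` for the
smallest eigenvalue of `Λ_t`.

Below this level the exploration bonus matters: moving from the estimate towards a bottom
eigenvector `w` of `Λ_t` guarantees a score that the chosen action can match only if its own `g = aᵀ
Λ_t⁻¹ a` is at least a constant multiple of `1 / λ_{t,d}` (`le_inner_designInv_of_ucb`). By
Sherman–Morrison each round lowers `tr Λ_t⁻¹` by at least `g² / 2`. Since `tr Λ_s⁻¹ ≤ d / λ_{s,d}`,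
comparing rounds `t / 2` and `t` inductively gives `t ≲ d λ_{t,d}` (`le_mul_designEig_last`). The
reverse bound `λ_{t,d} ≤ 1 + t / d` is the trace identity. Both hold for every outcome, whatever the
noise.

Hence the level is exceeded after order `β² d` rounds, and `t₁` is about 100 times that number.
Above the level the bonus is at most `1 / √R`, so LinUCB plays almost the estimate. The estimate is
accurate with high probability: a large noise error forces an exponential supermartingale to be
large at a point of a lattice (`exists_lattice_logExpMartingale_ge`), which a weighted union bound
excludes (`IsLinUCB.exists_good_event`). So at least 95% of the first `t₁` actions nearly equal `θ`;
the quadratic form at `θ` makes `λ_{t₁,1}` large, and the trace bound leaves little for `λ_{t₁,2}`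
(`half_le_designEig_sub`). -/

theorem inner_vec_eq_dotProduct (x y : Vec d) : inner ℝ x y = x.ofLp ⬝ᵥ y.ofLp := by
  rw [EuclideanSpace.inner_eq_star_dotProduct, dotProduct_comm]
  simp

/-- The linear operator with matrix `Λ_t`. -/
def designOp (a : ℕ → Vec d) (t : ℕ) : Vec d →ₗ[ℝ] Vec d :=
  Matrix.toEuclideanLin (designMatrix a t)

/-- The linear operator with matrix `Λ_t⁻¹`. -/
def designInv (a : ℕ → Vec d) (t : ℕ) : Vec d →ₗ[ℝ] Vec d :=
  Matrix.toEuclideanLin (designMatrix a t)⁻¹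

theorem designOp_apply (a : ℕ → Vec d) (t : ℕ) (x : Vec d) :
    designOp a t x = x + ∑ s ∈ Finset.Icc 1 t, (inner ℝ (a s) x : ℝ) • a s := by
  apply (WithLp.ofLp_injective 2)
  simp only [designOp, Matrix.toLpLin_apply, designMatrix, Matrix.add_mulVec, Matrix.one_mulVec,
    WithLp.ofLp_add, Matrix.sum_mulVec, Matrix.vecMulVec_mulVec, WithLp.ofLp_sum,
    WithLp.ofLp_smul, inner_vec_eq_dotProduct, op_smul_eq_smul]

theorem inner_designOp (a : ℕ → Vec d) (t : ℕ) (x y : Vec d) :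
    inner ℝ x (designOp a t y) =
      inner ℝ x y + ∑ s ∈ Finset.Icc 1 t, (inner ℝ (a s) x : ℝ) * inner ℝ (a s) y := by
  rw [designOp_apply, inner_add_right, inner_sum]
  congr 1
  refine Finset.sum_congr rfl fun s _ => ?_
  rw [inner_smul_right, real_inner_comm x (a s), mul_comm]

theorem inner_designOp_self (a : ℕ → Vec d) (t : ℕ) (x : Vec d) :
    inner ℝ x (designOp a t x) =
      ‖x‖ ^ 2 + ∑ s ∈ Finset.Icc 1 t, (inner ℝ (a s) x : ℝ) ^ 2 := by
  rw [inner_designOp, real_inner_self_eq_norm_sq]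
  simp only [sq]

theorem inner_designOp_comm (a : ℕ → Vec d) (t : ℕ) (x y : Vec d) :
    inner ℝ x (designOp a t y) = (inner ℝ (designOp a t x) y : ℝ) := by
  rw [real_inner_comm y, inner_designOp, inner_designOp, real_inner_comm x y]
  simp only [mul_comm]

theorem designOp_succ (a : ℕ → Vec d) (t : ℕ) (x : Vec d) :
    designOp a (t + 1) x = designOp a t x + (inner ℝ (a (t + 1)) x : ℝ) • a (t + 1) := by
  rw [designOp_apply, designOp_apply, Finset.sum_Icc_succ_top (by omega), add_assoc]

theorem isUnit_det_designMatrix (a : ℕ → Vec d) (t : ℕ) : IsUnit (designMatrix a t).det :=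
  (designMatrix_posDef a t).det_pos.ne'.isUnit

theorem designOp_designInv (a : ℕ → Vec d) (t : ℕ) (x : Vec d) :
    designOp a t (designInv a t x) = x := by
  apply (WithLp.ofLp_injective 2)
  simp [designOp, designInv, Matrix.toLpLin_apply,
    Matrix.mul_nonsing_inv _ (isUnit_det_designMatrix a t)]

theorem designInv_designOp (a : ℕ → Vec d) (t : ℕ) (x : Vec d) :
    designInv a t (designOp a t x) = x := by
  apply (WithLp.ofLp_injective 2)
  simp [designOp, designInv, Matrix.toLpLin_apply,
    Matrix.nonsing_inv_mul _ (isUnit_det_designMatrix a t)]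

theorem inner_designInv_comm (a : ℕ → Vec d) (t : ℕ) (x y : Vec d) :
    inner ℝ x (designInv a t y) = (inner ℝ (designInv a t x) y : ℝ) := by
  conv_lhs => rw [← designOp_designInv a t x]
  rw [← inner_designOp_comm, designOp_designInv]

theorem norm_sq_le_inner_designOp (a : ℕ → Vec d) (t : ℕ) (x : Vec d) :
    ‖x‖ ^ 2 ≤ inner ℝ x (designOp a t x) := by
  rw [inner_designOp_self]
  exact le_add_of_nonneg_right (Finset.sum_nonneg fun s _ => sq_nonneg _)

theorem inner_designInv_nonneg (a : ℕ → Vec d) (t : ℕ) (x : Vec d) :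
    0 ≤ (inner ℝ x (designInv a t x) : ℝ) := by
  have h := norm_sq_le_inner_designOp a t (designInv a t x)
  rw [designOp_designInv, real_inner_comm] at h
  exact (sq_nonneg _).trans h

theorem ucbScore_designMatrix (β : ℝ) (a : ℕ → Vec d) (t : ℕ) (y b : Vec d) :
    ucbScore β (designMatrix a t) y b =
      inner ℝ b y + β * √(inner ℝ b (designInv a t b)) := by
  rw [ucbScore, inner_vec_eq_dotProduct b (designInv a t b)]
  rfl

theorem ridge_eq_designInv (a : ℕ → Vec d) (r : ℕ → ℝ) (t : ℕ) :
    ridge a r t = designInv a t (∑ s ∈ Finset.Icc 1 t, r s • a s) := rfl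

/-! ### Eigenvalues of the design matrix -/

theorem designEig_antitone (a : ℕ → Vec d) (t : ℕ) : Antitone (designEig a t) := by
  intro i j hij
  exact (designMatrix_posDef a t).isHermitian.eigenvalues₀_antitone (by simpa using hij)

theorem exists_designEig_eq_eigenvalues (a : ℕ → Vec d) (t : ℕ) :
    ∃ e : Fin d ≃ Fin d, ∀ i, designEig a t i =
      (designMatrix_posDef a t).isHermitian.eigenvalues (e i) := by
  refine ⟨(finCongr (Fintype.card_fin d).symm).trans
    (Fintype.equivOfCardEq (Fintype.card_fin (Fintype.card (Fin d)))), fun i => ?_⟩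
  simp [designEig, Matrix.IsHermitian.eigenvalues]

theorem exists_eigenvector_basis (a : ℕ → Vec d) (t : ℕ) :
    ∃ v : OrthonormalBasis (Fin d) ℝ (Vec d),
      ∀ i, designOp a t (v i) = designEig a t i • v i := by
  obtain ⟨e, he⟩ := exists_designEig_eq_eigenvalues a t
  refine ⟨(designMatrix_posDef a t).isHermitian.eigenvectorBasis.reindex e.symm, fun i => ?_⟩
  apply (WithLp.ofLp_injective 2)
  rw [he, designOp, OrthonormalBasis.reindex_apply, Matrix.toLpLin_apply]
  exact (designMatrix_posDef a t).isHermitian.mulVec_eigenvectorBasis (e i)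

theorem inner_designOp_eq_sum {a : ℕ → Vec d} {t : ℕ} {v : OrthonormalBasis (Fin d) ℝ (Vec d)}
    (hv : ∀ i, designOp a t (v i) = designEig a t i • v i) (x : Vec d) :
    inner ℝ x (designOp a t x) = ∑ i, designEig a t i * (inner ℝ (v i) x : ℝ) ^ 2 := by
  rw [← v.sum_inner_mul_inner x (designOp a t x)]
  refine Finset.sum_congr rfl fun i _ => ?_
  rw [inner_designOp_comm, hv, inner_smul_left, real_inner_comm]
  simp
  ring

theorem inner_designOp_le (a : ℕ → Vec d) (t : ℕ) (i₀ : Fin d) (h0 : i₀.1 = 0) (x : Vec d) :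
    inner ℝ x (designOp a t x) ≤ designEig a t i₀ * ‖x‖ ^ 2 := by
  obtain ⟨v, hv⟩ := exists_eigenvector_basis a t
  rw [inner_designOp_eq_sum hv, ← v.sum_sq_norm_inner_right x, Finset.mul_sum]
  refine Finset.sum_le_sum fun i _ => ?_
  rw [Real.norm_eq_abs, sq_abs]
  exact mul_le_mul_of_nonneg_right (designEig_antitone a t (Fin.le_def.2 (by omega)))
    (sq_nonneg _)

theorem le_inner_designOp (a : ℕ → Vec d) (t : ℕ) (h : d - 1 < d) (x : Vec d) :
    designEig a t ⟨d - 1, h⟩ * ‖x‖ ^ 2 ≤ inner ℝ x (designOp a t x) := by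
  obtain ⟨v, hv⟩ := exists_eigenvector_basis a t
  rw [inner_designOp_eq_sum hv, ← v.sum_sq_norm_inner_right x, Finset.mul_sum]
  refine Finset.sum_le_sum fun i _ => ?_
  rw [Real.norm_eq_abs, sq_abs]
  exact mul_le_mul_of_nonneg_right (designEig_antitone a t (Fin.le_def.2 (by simp; omega)))
    (sq_nonneg _)

theorem one_le_designEig (a : ℕ → Vec d) (t : ℕ) (i : Fin d) : 1 ≤ designEig a t i := by
  obtain ⟨v, hv⟩ := exists_eigenvector_basis a t
  have h := norm_sq_le_inner_designOp a t (v i)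
  rw [hv, inner_smul_right, real_inner_self_eq_norm_sq] at h
  simpa using h

theorem sum_designEig (a : ℕ → Vec d) (t : ℕ) :
    ∑ i, designEig a t i = d + ∑ s ∈ Finset.Icc 1 t, ‖a s‖ ^ 2 := by
  obtain ⟨e, he⟩ := exists_designEig_eq_eigenvalues a t
  have h := (designMatrix_posDef a t).isHermitian.trace_eq_sum_eigenvalues
  simp only [he, Equiv.sum_comp e]
  have h2 : (designMatrix a t).trace = d + ∑ s ∈ Finset.Icc 1 t, ‖a s‖ ^ 2 := by
    simp only [designMatrix, Matrix.trace_add, Matrix.trace_one, Fintype.card_fin,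
      Matrix.trace_sum, Matrix.trace_vecMulVec, ← inner_vec_eq_dotProduct,
      real_inner_self_eq_norm_sq]
  rw [← h2, h]
  simp

theorem sum_designEig_le {a : ℕ → Vec d} {t : ℕ} (ha : ∀ s, 1 ≤ s → s ≤ t → ‖a s‖ ≤ 1) :
    ∑ i, designEig a t i ≤ d + t := by
  rw [sum_designEig]
  have : ∑ s ∈ Finset.Icc 1 t, ‖a s‖ ^ 2 ≤ ∑ s ∈ Finset.Icc 1 t, (1 : ℝ) :=
    Finset.sum_le_sum fun s hs => by
      rw [Finset.mem_Icc] at hs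
      exact pow_le_one₀ (norm_nonneg _) (ha s hs.1 hs.2)
  simpa using this

/-- A bottom eigenvector of `Λ_{t+1}` serves as test vector for the Rayleigh quotient of `Λ_t`. -/
theorem designEig_last_mono (a : ℕ → Vec d) (h : d - 1 < d) :
    Monotone fun t => designEig a t ⟨d - 1, h⟩ := by
  refine monotone_nat_of_le_succ fun t => ?_
  obtain ⟨v, hv⟩ := exists_eigenvector_basis a (t + 1)
  have h1 := le_inner_designOp a t h (v ⟨d - 1, h⟩)
  have h2 : inner ℝ (v ⟨d - 1, h⟩) (designOp a (t + 1) (v ⟨d - 1, h⟩)) =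
      designEig a (t + 1) ⟨d - 1, h⟩ := by
    rw [hv, inner_smul_right, real_inner_self_eq_norm_sq]
    simp
  rw [designOp_succ, inner_add_right, inner_smul_right,
    real_inner_comm (v ⟨d - 1, h⟩) (a (t + 1))] at h2
  have h3 := mul_self_nonneg (inner ℝ (v ⟨d - 1, h⟩) (a (t + 1)) : ℝ)
  simp only [OrthonormalBasis.norm_eq_one, one_pow, mul_one] at h1
  linarith

theorem norm_designInv_le (a : ℕ → Vec d) (t : ℕ) (h : d - 1 < d) (x : Vec d) :
    ‖designInv a t x‖ ≤ ‖x‖ / designEig a t ⟨d - 1, h⟩ := by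
  have hpos : 0 < designEig a t ⟨d - 1, h⟩ := one_pos.trans_le (one_le_designEig a t _)
  rw [le_div_iff₀ hpos]
  have h1 := le_inner_designOp a t h (designInv a t x)
  rw [designOp_designInv] at h1
  have h2 := real_inner_le_norm (designInv a t x) x
  rcases (norm_nonneg (designInv a t x)).eq_or_lt with h0 | h0
  · rw [← h0]; simp
  · refine le_of_mul_le_mul_left ?_ h0
    nlinarith

theorem inner_designInv_le (a : ℕ → Vec d) (t : ℕ) (h : d - 1 < d) (x : Vec d) :
    inner ℝ x (designInv a t x) ≤ ‖x‖ ^ 2 / designEig a t ⟨d - 1, h⟩ := by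
  have h2 := real_inner_le_norm x (designInv a t x)
  have h3 := mul_le_mul_of_nonneg_left (norm_designInv_le a t h x) (norm_nonneg x)
  rw [sq, mul_div_assoc]
  exact h2.trans h3

/-! ### The trace of the inverse design matrix -/

/-- The trace of `Λ_t⁻¹`. -/
def traceInv (a : ℕ → Vec d) (t : ℕ) : ℝ :=
  ∑ i, inner ℝ (EuclideanSpace.basisFun (Fin d) ℝ i)
    (designInv a t (EuclideanSpace.basisFun (Fin d) ℝ i))

theorem traceInv_nonneg (a : ℕ → Vec d) (t : ℕ) : 0 ≤ traceInv a t :=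
  Finset.sum_nonneg fun _ _ => inner_designInv_nonneg a t _

theorem traceInv_le (a : ℕ → Vec d) (t : ℕ) (h : d - 1 < d) :
    traceInv a t ≤ d / designEig a t ⟨d - 1, h⟩ := by
  have : traceInv a t ≤ ∑ _i : Fin d, 1 / designEig a t ⟨d - 1, h⟩ :=
    Finset.sum_le_sum fun i _ => by
      simpa using inner_designInv_le a t h (EuclideanSpace.basisFun (Fin d) ℝ i)
  simpa [div_eq_mul_inv] using this

/-- Sherman–Morrison, checked by applying `Λ_{t+1}` to the right-hand side. -/
theorem designInv_succ (a : ℕ → Vec d) (t : ℕ) (x : Vec d) :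
    designInv a (t + 1) x = designInv a t x -
      (inner ℝ (designInv a t (a (t + 1))) x /
        (1 + inner ℝ (a (t + 1)) (designInv a t (a (t + 1)))) : ℝ) •
          designInv a t (a (t + 1)) := by
  have hpos : 0 < 1 + (inner ℝ (a (t + 1)) (designInv a t (a (t + 1))) : ℝ) := by
    linarith [inner_designInv_nonneg a t (a (t + 1))]
  conv_rhs => rw [← designInv_designOp a (t + 1) (designInv a t x - _)]
  congr 1
  rw [designOp_succ, map_sub, map_smul, designOp_designInv, designOp_designInv, inner_sub_right,
    inner_smul_right, inner_designInv_comm a t _ x]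
  generalize hc : (inner ℝ (designInv a t (a (t + 1))) x : ℝ) = c at *
  generalize hg : (inner ℝ (a (t + 1)) (designInv a t (a (t + 1))) : ℝ) = g at *
  rw [sub_add, ← sub_smul]
  have : c / (1 + g) - (c - c / (1 + g) * g) = 0 := by field_simp; ring
  rw [this, zero_smul, sub_zero]

theorem traceInv_succ (a : ℕ → Vec d) (t : ℕ) :
    traceInv a (t + 1) = traceInv a t - ‖designInv a t (a (t + 1))‖ ^ 2 /
        (1 + inner ℝ (a (t + 1)) (designInv a t (a (t + 1)))) := by
  rw [← (EuclideanSpace.basisFun (Fin d) ℝ).sum_sq_norm_inner_right, Finset.sum_div, traceInv,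
    traceInv, ← Finset.sum_sub_distrib]
  refine Finset.sum_congr rfl fun i _ => ?_
  rw [designInv_succ, inner_sub_right, inner_smul_right, Real.norm_eq_abs, sq_abs,
    real_inner_comm (EuclideanSpace.basisFun (Fin d) ℝ i) (designInv a t (a (t + 1)))]
  ring

/-- With `g = aᵀ Λ⁻¹ a`, Cauchy–Schwarz gives `g ≤ ‖Λ⁻¹ a‖`, and `Λ ≥ I` gives `g ≤ 1`, so the
denominator in `traceInv_succ` is at most 2. -/
theorem traceInv_succ_le {a : ℕ → Vec d} {t : ℕ} (h : d - 1 < d) (ha : ‖a (t + 1)‖ ≤ 1) :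
    traceInv a (t + 1) ≤
      traceInv a t - (inner ℝ (a (t + 1)) (designInv a t (a (t + 1))) : ℝ) ^ 2 / 2 := by
  rw [traceInv_succ]
  have h0 := inner_designInv_nonneg a t (a (t + 1))
  have h1 := inner_designInv_le a t h (a (t + 1))
  have h2 : ‖a (t + 1)‖ ^ 2 / designEig a t ⟨d - 1, h⟩ ≤ 1 :=
    div_le_one_of_le₀ ((pow_le_one₀ (norm_nonneg _) ha).trans (one_le_designEig a t _))
      (zero_le_one.trans (one_le_designEig a t _))
  have h3 : (inner ℝ (a (t + 1)) (designInv a t (a (t + 1))) : ℝ) ≤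
      ‖designInv a t (a (t + 1))‖ :=
    (real_inner_le_norm _ _).trans (mul_le_of_le_one_left (norm_nonneg _) ha)
  have h4 := pow_le_pow_left₀ h0 h3 2
  have h5 := div_le_div₀ (sq_nonneg ‖designInv a t (a (t + 1))‖) h4 (by linarith)
    (show 1 + (inner ℝ (a (t + 1)) (designInv a t (a (t + 1))) : ℝ) ≤ 2 by linarith)
  linarith

end

noncomputable section

/-! ### Deterministic consequences of the UCB rule -/

variable {d : ℕ}

theorem exists_unit_eigenvector (a : ℕ → Vec d) (t : ℕ) (h : d - 1 < d) (y : Vec d) :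
    ∃ w : Vec d, ‖w‖ = 1 ∧ 0 ≤ (inner ℝ w y : ℝ) ∧
      designInv a t w = (designEig a t ⟨d - 1, h⟩)⁻¹ • w := by
  obtain ⟨v, hv⟩ := exists_eigenvector_basis a t
  have hpos : 0 < designEig a t ⟨d - 1, h⟩ := one_pos.trans_le (one_le_designEig a t _)
  have hinv : designInv a t (v ⟨d - 1, h⟩) = (designEig a t ⟨d - 1, h⟩)⁻¹ • v ⟨d - 1, h⟩ := by
    have := congrArg (designInv a t) (hv ⟨d - 1, h⟩)
    rw [designInv_designOp, map_smul] at this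
    rw [eq_inv_smul_iff₀ hpos.ne', ← this]
  rcases le_total 0 (inner ℝ (v ⟨d - 1, h⟩) y : ℝ) with h0 | h0
  · exact ⟨v ⟨d - 1, h⟩, by simp, h0, hinv⟩
  · exact ⟨-v ⟨d - 1, h⟩, by simp, by rw [inner_neg_left]; linarith, by
      rw [map_neg, hinv, smul_neg]⟩

/-- Removing the `w`-component of `b` lowers the form by exactly the left-hand side, and what
remains is nonnegative. -/
theorem inner_sq_le_inner_designInv {a : ℕ → Vec d} {t : ℕ} {m : ℝ} {w : Vec d}
    (hw : ‖w‖ = 1) (hm : designInv a t w = m • w) (b : Vec d) :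
    m * (inner ℝ b w : ℝ) ^ 2 ≤ inner ℝ b (designInv a t b) := by
  have h := inner_designInv_nonneg a t (b - (inner ℝ b w : ℝ) • w)
  rw [map_sub, map_smul, hm, inner_sub_left, inner_sub_right, inner_sub_right, inner_smul_left,
    inner_smul_left, inner_smul_right, inner_smul_right, inner_smul_right, inner_smul_right,
    inner_designInv_comm a t w b, hm, inner_smul_left, real_inner_self_eq_norm_sq w, hw,
    real_inner_comm b w] at h
  simp only [conj_trivial] at h
  linarith

/-- The witness is the normalization of `b₀ = y + β √m w`, with `w` a bottom eigenvector and `m = 1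
/ λ_min`. Bounding the bonus below by `β √m ⟨b, w⟩` turns the score into the linear form `⟨b, b₀⟩ =
‖b₀‖`. The sign of `w` is chosen so that the cross term in `‖b₀‖²` is nonnegative. -/
theorem exists_ucbScore_ge (a : ℕ → Vec d) (t : ℕ) (h : d - 1 < d) {β : ℝ} (hβ : 0 < β)
    (y : Vec d) : ∃ b : Vec d, ‖b‖ ≤ 1 ∧
      √(‖y‖ ^ 2 + β ^ 2 * (designEig a t ⟨d - 1, h⟩)⁻¹) ≤
        ucbScore β (designMatrix a t) y b := by
  obtain ⟨w, hw, hwy, hinv⟩ := exists_unit_eigenvector a t h y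
  have hpos : 0 < designEig a t ⟨d - 1, h⟩ := one_pos.trans_le (one_le_designEig a t _)
  set m := (designEig a t ⟨d - 1, h⟩)⁻¹ with hm
  have hm0 : 0 < m := inv_pos.2 hpos
  set b₀ := y + (β * √m) • w with hb₀
  have hsq : ‖b₀‖ ^ 2 = ‖y‖ ^ 2 + 2 * (β * √m) * inner ℝ w y + β ^ 2 * m := by
    rw [hb₀, norm_add_sq_real, inner_smul_right, norm_smul, hw, real_inner_comm w y,
      Real.norm_eq_abs, mul_one, sq_abs, mul_pow, Real.sq_sqrt hm0.le]
    ring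
  have hcross : 0 ≤ 2 * (β * √m) * (inner ℝ w y : ℝ) := by positivity
  have hb0pos : 0 < ‖b₀‖ := by
    refine lt_of_pow_lt_pow_left₀ 2 (norm_nonneg _) ?_
    rw [hsq]
    have : 0 < β ^ 2 * m := by positivity
    nlinarith [sq_nonneg ‖y‖]
  refine ⟨‖b₀‖⁻¹ • b₀, by rw [norm_smul, norm_inv, norm_norm, inv_mul_cancel₀ hb0pos.ne'], ?_⟩
  have h1 : √(‖y‖ ^ 2 + β ^ 2 * m) ≤ ‖b₀‖ := by
    apply Real.sqrt_le_iff.2 ⟨norm_nonneg _, ?_⟩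
    rw [hsq]
    linarith
  refine h1.trans ?_
  rw [ucbScore_designMatrix]
  have h2 : √m * inner ℝ (‖b₀‖⁻¹ • b₀) w ≤
      √(inner ℝ (‖b₀‖⁻¹ • b₀) (designInv a t (‖b₀‖⁻¹ • b₀))) := by
    apply Real.le_sqrt_of_sq_le
    rw [mul_pow, Real.sq_sqrt hm0.le]
    exact inner_sq_le_inner_designInv hw hinv _
  have h3 : ‖b₀‖ = inner ℝ (‖b₀‖⁻¹ • b₀) y + β * (√m * inner ℝ (‖b₀‖⁻¹ • b₀) w) := by
    have : (inner ℝ (‖b₀‖⁻¹ • b₀) b₀ : ℝ) = ‖b₀‖ := by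
      rw [inner_smul_left, real_inner_self_eq_norm_sq, conj_trivial, sq,
        inv_mul_cancel_left₀ hb0pos.ne']
    conv_lhs => rw [← this]
    conv_lhs => rw [hb₀]
    rw [← hb₀, inner_add_right, inner_smul_right]
    ring
  nlinarith

/-- The UCB action has a large variance proxy as long as the smallest eigenvalue of the design
matrix is at most of order `β²`. -/
theorem le_inner_designInv_of_ucb {a : ℕ → Vec d} {t : ℕ} (h : d - 1 < d) {β R : ℝ} (hβ : 0 < β)
    (hR : 1 ≤ R) (hlam : designEig a t ⟨d - 1, h⟩ ≤ R * β ^ 2) {y x : Vec d} (hy : ‖y‖ ≤ 1)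
    (hx : ‖x‖ ≤ 1)
    (hmax : ∀ b : Vec d, ‖b‖ ≤ 1 →
      ucbScore β (designMatrix a t) y b ≤ ucbScore β (designMatrix a t) y x) :
    1 / (16 * R) / designEig a t ⟨d - 1, h⟩ ≤ inner ℝ x (designInv a t x) := by
  have hpos : 0 < designEig a t ⟨d - 1, h⟩ := one_pos.trans_le (one_le_designEig a t _)
  obtain ⟨b, hb, hb2⟩ := exists_ucbScore_ge a t h hβ y
  have h1 := hb2.trans (hmax b hb)
  rw [ucbScore_designMatrix] at h1
  set g := (inner ℝ x (designInv a t x) : ℝ)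
  have hg : 0 ≤ g := inner_designInv_nonneg a t x
  have h2 : (inner ℝ x y : ℝ) ≤ ‖y‖ :=
    (real_inner_le_norm _ _).trans (mul_le_of_le_one_left (norm_nonneg _) hx)
  have h3 : √(‖y‖ ^ 2 + β ^ 2 * (designEig a t ⟨d - 1, h⟩)⁻¹) ≤ ‖y‖ + β * √g := by linarith
  set l := designEig a t ⟨d - 1, h⟩
  have h4 : ‖y‖ ^ 2 + β ^ 2 * l⁻¹ ≤ (‖y‖ + β * √g) ^ 2 := by
    have := Real.sqrt_le_iff.1 h3
    exact this.2
  have hp : 0 ≤ β * √g := by positivity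
  have h5 : β ^ 2 * l⁻¹ ≤ (β * √g) ^ 2 + 2 * (β * √g) := by nlinarith
  by_contra hcon
  rw [not_le] at hcon
  have h6 : (β * √g) ^ 2 = β ^ 2 * g := by rw [mul_pow, Real.sq_sqrt hg]
  set z := β ^ 2 * l⁻¹ with hz
  have hz0 : 0 < z := by positivity
  have hzR : 1 ≤ R * z := by
    rw [hz, ← mul_assoc, ← div_eq_mul_inv, le_div_iff₀ hpos]
    linarith
  have h7 : (β * √g) ^ 2 < z / (16 * R) := by
    rw [h6, hz]
    calc β ^ 2 * g < β ^ 2 * (1 / (16 * R) / l) := by gcongr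
      _ = _ := by field_simp
  -- Since `z ≥ 1 / R`, the assumed bound `z / (16 R)` is at most `z² / 16`. Then `p = β √g`
  -- satisfies `p² + 2 p < z / 16 + z / 2`, contradicting `h5`.
  have h8 : (β * √g) ^ 2 < (z / 4) ^ 2 := by
    refine h7.trans_le ?_
    rw [div_le_iff₀ (by positivity)]
    nlinarith
  have h9 : β * √g < z / 4 := lt_of_pow_lt_pow_left₀ 2 (by positivity) h8
  have h10 : z / (16 * R) ≤ z / 16 := by
    gcongr
    linarith
  linarith

/-- If every action has a variance proxy of the order of the largest possible one, the smallest
eigenvalue of the design matrix grows linearly. -/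
theorem le_mul_designEig_last {a : ℕ → Vec d} (h : d - 1 < d) {q : ℝ} (hq : 0 < q) (hq1 : q ≤ 1)
    {n : ℕ} (hn : ∀ s < n, ‖a (s + 1)‖ ≤ 1 ∧
      q / designEig a s ⟨d - 1, h⟩ ≤ inner ℝ (a (s + 1)) (designInv a s (a (s + 1)))) :
    ∀ t ≤ n, (t : ℝ) ≤ 12 / q ^ 2 * (d * designEig a t ⟨d - 1, h⟩) := by
  have hpos : ∀ t, 0 < designEig a t ⟨d - 1, h⟩ := fun t =>
    one_pos.trans_le (one_le_designEig a t _)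
  have hd : (1 : ℝ) ≤ d := by exact_mod_cast (by omega : 1 ≤ d)
  have hmono := designEig_last_mono a h
  -- The smallest eigenvalue is nondecreasing, so every round between `s` and `t` lowers the trace
  -- by at least the amount computed with `λ_t`.
  have hdecr : ∀ s t, s ≤ t → t ≤ n →
      traceInv a t + (t - s) * ((q / designEig a t ⟨d - 1, h⟩) ^ 2 / 2) ≤ traceInv a s := by
    intro s t hst htn
    suffices ∀ u, s ≤ u → u ≤ t →
        traceInv a u + (u - s) * ((q / designEig a t ⟨d - 1, h⟩) ^ 2 / 2) ≤ traceInv a s from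
      this t hst le_rfl
    intro u hsu
    induction u, hsu using Nat.le_induction with
    | base => intro _; simp
    | succ u hsu ih =>
      intro hut
      have h1 := ih (by omega)
      have h2 := traceInv_succ_le h (hn u (by omega)).1
      have h3 : (q / designEig a t ⟨d - 1, h⟩) ^ 2 ≤
          (inner ℝ (a (u + 1)) (designInv a u (a (u + 1))) : ℝ) ^ 2 := by
        have h4 : q / designEig a t ⟨d - 1, h⟩ ≤ q / designEig a u ⟨d - 1, h⟩ :=
          div_le_div_of_nonneg_left hq.le (hpos u) (hmono (by omega))
        have := hpos t
        exact pow_le_pow_left₀ (by positivity) (h4.trans (hn u (by omega)).2) 2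
      push_cast
      linarith
  intro t
  induction t using Nat.strong_induction_on with
  | _ t ih =>
    intro htn
    have hlt := one_le_designEig a t ⟨d - 1, h⟩
    -- Halving needs `t ≥ 2`: for `t = 1` the midpoint is 0 and `t / 3 ≤ t / 2` fails in integers.
    rcases Nat.lt_or_ge t 2 with ht | ht
    · have h1 : (t : ℝ) ≤ 1 := by exact_mod_cast (by omega : t ≤ 1)
      have h2 : 1 ≤ 12 / q ^ 2 := by
        rw [le_div_iff₀ (by positivity)]
        nlinarith
      nlinarith [mul_le_mul hd hlt zero_le_one (by linarith)]
    · set s := t / 2 with hs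
      have h1 := ih s (by omega) (by omega)
      have h2 := hdecr s t (by omega) htn
      have h3 := traceInv_nonneg a t
      have h4 := traceInv_le a s h
      have hs3 : (t : ℝ) / 3 ≤ s := by
        rw [div_le_iff₀ (by norm_num)]
        exact_mod_cast (by omega : t ≤ s * 3)
      have hts : (t : ℝ) / 2 ≤ t - s := by
        have : (s : ℝ) * 2 ≤ t := by exact_mod_cast (by omega : s * 2 ≤ t)
        linarith
      have ht0 : (0 : ℝ) < t := by exact_mod_cast (by omega : 0 < t)
      set l := designEig a t ⟨d - 1, h⟩
      set ls := designEig a s ⟨d - 1, h⟩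
      have hls : 0 < ls := hpos s
      have hl : 0 < l := hpos t
      have h5 : t / 2 * ((q / l) ^ 2 / 2) ≤ d / ls := by
        have : t / 2 * ((q / l) ^ 2 / 2) ≤ (t - s) * ((q / l) ^ 2 / 2) := by gcongr
        linarith
      have h6 : (d : ℝ) / ls ≤ 12 / q ^ 2 * (d * d) / (t / 3) := by
        rw [div_le_div_iff₀ hls (by positivity)]
        have : (d : ℝ) * (t / 3) ≤ d * (12 / q ^ 2 * (d * ls)) := by
          gcongr
          linarith
        linarith
      have h7 := h5.trans h6
      rw [le_div_iff₀ (by positivity)] at h7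
      -- The constant 12 reproduces itself: `K = 12 / q²` solves `K² = (12 / q²) K`, so the
      -- induction closes without loss.
      have h8 : (t : ℝ) ^ 2 ≤ (12 / q ^ 2 * (d * l)) ^ 2 := by
        have h9 : t / 2 * ((q / l) ^ 2 / 2) * (t / 3) = (t : ℝ) ^ 2 * (q ^ 2 / (12 * l ^ 2)) := by
          field_simp
          norm_num
        rw [h9, ← le_div_iff₀ (by positivity)] at h7
        refine h7.trans (le_of_eq ?_)
        field_simp
      exact (pow_le_pow_iff_left₀ ht0.le (by positivity) two_ne_zero).1 h8

/-- Along a UCB run the smallest eigenvalue grows linearly until it exceeds `R β²`. -/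
theorem le_mul_designEig_of_ucb {a : ℕ → Vec d} (h : d - 1 < d) {β R : ℝ} (hβ : 0 < β)
    (hR : 1 ≤ R) {n : ℕ} (hn : ∀ s < n, ‖a (s + 1)‖ ≤ 1 ∧ ∃ y : Vec d, ‖y‖ ≤ 1 ∧
      ∀ b : Vec d, ‖b‖ ≤ 1 → ucbScore β (designMatrix a s) y b ≤
        ucbScore β (designMatrix a s) y (a (s + 1)))
    (hlam : designEig a n ⟨d - 1, h⟩ ≤ R * β ^ 2) :
    (n : ℝ) ≤ 3072 * R ^ 2 * (d * designEig a n ⟨d - 1, h⟩) := by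
  have hq1 : 1 / (16 * R) ≤ 1 := by
    rw [div_le_one (by positivity)]
    linarith
  have := le_mul_designEig_last h (q := 1 / (16 * R)) (by positivity) hq1 (n := n)
    (fun s hs => ⟨(hn s hs).1, by
      obtain ⟨y, hy, hmax⟩ := (hn s hs).2
      exact le_inner_designInv_of_ucb h hβ hR
        ((designEig_last_mono a h hs.le).trans hlam) hy (hn s hs).1 hmax⟩) n le_rfl
  convert this using 2
  field_simp
  norm_num

/-- If the estimate is a unit vector, the UCB action is close to it as soon as the smallest
eigenvalue of the design matrix is large compared with `β²`. -/
theorem inner_ge_of_ucb {a : ℕ → Vec d} {t : ℕ} (h : d - 1 < d) {β R : ℝ} (hβ : 0 < β)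
    (hR : 0 < R) (hlam : R * β ^ 2 ≤ designEig a t ⟨d - 1, h⟩) {y x : Vec d} (hy : ‖y‖ = 1)
    (hx : ‖x‖ ≤ 1)
    (hmax : ∀ b : Vec d, ‖b‖ ≤ 1 →
      ucbScore β (designMatrix a t) y b ≤ ucbScore β (designMatrix a t) y x) :
    1 - 1 / √R ≤ inner ℝ x y := by
  have h1 := hmax y hy.le
  rw [ucbScore_designMatrix, ucbScore_designMatrix, real_inner_self_eq_norm_sq, hy] at h1
  have h2 : (inner ℝ x (designInv a t x) : ℝ) ≤ 1 / (R * β ^ 2) :=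
    (inner_designInv_le a t h x).trans
      (div_le_div₀ zero_le_one (pow_le_one₀ (norm_nonneg _) hx) (by positivity) hlam)
  have h3 : β * √(inner ℝ x (designInv a t x)) ≤ 1 / √R := by
    calc β * √(inner ℝ x (designInv a t x)) ≤ β * √(1 / (R * β ^ 2)) := by gcongr
      _ = 1 / √R := by
        rw [Real.sqrt_div zero_le_one, Real.sqrt_mul hR.le, Real.sqrt_sq hβ.le, Real.sqrt_one]
        field_simp
  have h4 : 0 ≤ β * √(inner ℝ y (designInv a t y)) := by positivity
  linarith

end

noncomputable section

/-! ### The spectral gap -/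

variable {d : ℕ}

/-- If most actions are aligned with a unit vector, the design matrix has a spectral gap. -/
theorem half_le_designEig_sub {a : ℕ → Vec d} {t n : ℕ} {θ : Vec d} (i₀ i₁ : Fin d)
    (h0 : i₀.1 = 0) (h1 : i₁.1 = 1) (hθ : ‖θ‖ = 1) (hnt : (n : ℝ) ≤ t / 20)
    (ha : ∀ s, 1 ≤ s → s ≤ t → ‖a s‖ ≤ 1)
    (hal : ∀ s, n < s → s ≤ t → 9 / 10 ≤ (inner ℝ (a s) θ : ℝ)) :
    (t : ℝ) / 2 ≤ designEig a t i₀ - designEig a t i₁ := by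
  have hl := inner_designOp_le a t i₀ h0 θ
  rw [inner_designOp_self, hθ] at hl
  have ht0 : (0 : ℝ) ≤ t := t.cast_nonneg
  have hle : n ≤ t := by
    have : (n : ℝ) ≤ t := by linarith
    exact_mod_cast this
  have hsum : ((t : ℝ) - n) * (81 / 100) ≤ ∑ s ∈ Finset.Icc 1 t, (inner ℝ (a s) θ : ℝ) ^ 2 := by
    calc ((t : ℝ) - n) * (81 / 100) = ∑ s ∈ Finset.Ioc n t, (81 / 100 : ℝ) := by
          simp [Nat.cast_sub hle]
      _ ≤ ∑ s ∈ Finset.Ioc n t, (inner ℝ (a s) θ : ℝ) ^ 2 := Finset.sum_le_sum fun s hs => by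
          rw [Finset.mem_Ioc] at hs
          nlinarith [hal s hs.1 hs.2]
      _ ≤ _ := Finset.sum_le_sum_of_subset_of_nonneg
          (fun s hs => by rw [Finset.mem_Ioc] at hs; rw [Finset.mem_Icc]; omega)
          fun _ _ _ => sq_nonneg _
  have htr := sum_designEig_le ha
  have hne : i₁ ≠ i₀ := fun h => by rw [h] at h1; omega
  -- The other `d - 2` eigenvalues are at least 1, so `λ₁ + λ₂ ≤ t + 2`. With `λ₁ ≥ 1 + 0.81 · 0.95
  -- t` the gap `2 λ₁ - (λ₁ + λ₂)` is at least `0.539 t`.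
  rw [← Finset.add_sum_erase _ _ (Finset.mem_univ i₀),
    ← Finset.add_sum_erase _ _ (Finset.mem_erase.2 ⟨hne, Finset.mem_univ i₁⟩)] at htr
  have hrest : (d : ℝ) - 2 ≤ ∑ i ∈ (Finset.univ.erase i₀).erase i₁, designEig a t i := by
    have hc : ((Finset.univ.erase i₀).erase i₁).card = d - 2 := by
      rw [Finset.card_erase_of_mem (Finset.mem_erase.2 ⟨hne, Finset.mem_univ i₁⟩),
        Finset.card_erase_of_mem (Finset.mem_univ i₀), Finset.card_univ, Fintype.card_fin]
      omega
    have h2 : 2 ≤ d := by have := i₁.2; omega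
    calc (d : ℝ) - 2 = ∑ i ∈ (Finset.univ.erase i₀).erase i₁, (1 : ℝ) := by
          rw [Finset.sum_const, hc, nsmul_eq_mul, mul_one, Nat.cast_sub h2]
          norm_num
      _ ≤ _ := Finset.sum_le_sum fun i _ => one_le_designEig a t i
  linarith

/-! ### The error of the ridge estimator -/

theorem ridge_sub (a : ℕ → Vec d) (r : ℕ → ℝ) (t : ℕ) (θ : Vec d) :
    ridge a r t - θ =
      designInv a t (∑ s ∈ Finset.Icc 1 t, (r s - inner ℝ (a s) θ) • a s) -
        designInv a t θ := by
  rw [ridge_eq_designInv, ← map_sub]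
  conv_lhs => rw [← designInv_designOp a t θ]
  rw [← map_sub, designOp_apply]
  congr 1
  simp only [sub_smul, Finset.sum_sub_distrib]
  abel

theorem norm_ridge_sub_le {a : ℕ → Vec d} {r : ℕ → ℝ} {t : ℕ} {θ : Vec d} (h : d - 1 < d)
    (hθ : ‖θ‖ = 1) :
    ‖ridge a r t - θ‖ ≤
      ‖designInv a t (∑ s ∈ Finset.Icc 1 t, (r s - inner ℝ (a s) θ) • a s)‖ +
        1 / designEig a t ⟨d - 1, h⟩ := by
  rw [ridge_sub]
  refine (norm_sub_le _ _).trans ?_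
  have := norm_designInv_le a t h θ
  rw [hθ] at this
  linarith

theorem norm_sphereProj_sub_le {x y θ : Vec d} (hθ : ‖θ‖ = 1) (hx : ‖x - θ‖ < 1)
    (hy : IsSphereProj x y) : ‖y‖ = 1 ∧ ‖y - θ‖ ≤ 2 * ‖x - θ‖ := by
  have hx0 : x ≠ 0 := by
    rintro rfl
    rw [zero_sub, norm_neg, hθ] at hx
    exact lt_irrefl _ hx
  have hxpos : 0 < ‖x‖ := norm_pos_iff.2 hx0
  rw [hy.1 hx0]
  have h1 : ‖‖x‖⁻¹ • x‖ = 1 := by rw [norm_smul, norm_inv, norm_norm, inv_mul_cancel₀ hxpos.ne']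
  refine ⟨h1, ?_⟩
  have h2 : ‖‖x‖⁻¹ • x - x‖ = |1 - ‖x‖| := by
    have : ‖x‖⁻¹ • x - x = (1 - ‖x‖) • (‖x‖⁻¹ • x) := by
      rw [sub_smul, one_smul, smul_inv_smul₀ hxpos.ne']
    rw [this, norm_smul, h1, mul_one, Real.norm_eq_abs]
  have h3 : |1 - ‖x‖| ≤ ‖x - θ‖ := by
    have := abs_norm_sub_norm_le x θ
    rwa [hθ, abs_sub_comm] at this
  calc ‖‖x‖⁻¹ • x - θ‖ = ‖(‖x‖⁻¹ • x - x) + (x - θ)‖ := by rw [sub_add_sub_cancel]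
    _ ≤ ‖‖x‖⁻¹ • x - x‖ + ‖x - θ‖ := norm_add_le _ _
    _ ≤ 2 * ‖x - θ‖ := by linarith

/-! ### Rounding to a lattice -/

/-- Of the two neighbouring multiples of `h`, the one on the side where the linear term increases is
taken, so only the quadratic term can cost anything. This avoids any control of the gradient. -/
theorem exists_int_rounding {h α b u : ℝ} (hh : 0 < h) (hα : 0 ≤ α) :
    ∃ n : ℤ, |n * h - u| ≤ h ∧ -(h ^ 2 * α) ≤ (n * h - u) * b - (n * h - u) ^ 2 * α := by
  have h1 : (⌊u / h⌋ : ℝ) * h ≤ u := (le_div_iff₀ hh).1 (Int.floor_le _)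
  have h2 : u < ((⌊u / h⌋ : ℝ) + 1) * h := (div_lt_iff₀ hh).1 (Int.lt_floor_add_one _)
  rcases le_total b 0 with hb | hb
  · refine ⟨⌊u / h⌋, abs_le.2 ⟨by linarith, by linarith⟩, ?_⟩
    have h3 : ((⌊u / h⌋ : ℝ) * h - u) ^ 2 ≤ h ^ 2 :=
      sq_le_sq.2 (by rw [abs_of_pos hh]; exact abs_le.2 ⟨by linarith, by linarith⟩)
    have h4 := mul_nonneg_of_nonpos_of_nonpos (sub_nonpos.2 h1) hb
    nlinarith
  · refine ⟨⌊u / h⌋ + 1, ?_⟩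
    push_cast
    have h5 : |((⌊u / h⌋ : ℝ) + 1) * h - u| ≤ h := abs_le.2 ⟨by linarith, by linarith⟩
    refine ⟨h5, ?_⟩
    have h3 : (((⌊u / h⌋ : ℝ) + 1) * h - u) ^ 2 ≤ h ^ 2 :=
      sq_le_sq.2 (by rwa [abs_of_pos hh])
    have h4 := mul_nonneg (sub_nonneg.2 h2.le) hb
    nlinarith

/-- The coordinates of a point can be rounded to multiples of `h` one after the other without
decreasing a concave quadratic function by more than `h²` times the sum of its second order
coefficients. -/
theorem exists_lattice_rounding {f : Vec d → ℝ} {b : Vec d → Fin d → ℝ} {α : Fin d → ℝ}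
    (hα : ∀ i, 0 ≤ α i)
    (hf : ∀ x i τ, f (x + τ • EuclideanSpace.single i 1) = f x + τ * b x i - τ ^ 2 * α i)
    {h : ℝ} (hh : 0 < h) (x : Vec d) :
    ∃ n : Fin d → ℤ, (∀ i, |n i * h - x i| ≤ h) ∧
      f x - h ^ 2 * ∑ i, α i ≤ f (WithLp.toLp 2 fun i => (n i : ℝ) * h) := by
  suffices ∀ s : Finset (Fin d), ∃ n : Fin d → ℤ, ∃ z : Vec d, (∀ i, |n i * h - x i| ≤ h) ∧
      (∀ i ∈ s, z i = n i * h) ∧ (∀ i ∉ s, z i = x i) ∧ f x - h ^ 2 * ∑ i ∈ s, α i ≤ f z by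
    obtain ⟨n, z, h1, h2, -, h4⟩ := this Finset.univ
    refine ⟨n, h1, ?_⟩
    convert h4 using 2
    ext i
    exact (h2 i (Finset.mem_univ i)).symm
  intro s
  induction s using Finset.induction_on with
  | empty =>
    -- The point has not moved yet; any rounding within `h` will do, and it is overwritten
    -- coordinate by coordinate.
    choose n hn using fun i => exists_int_rounding (α := 0) (b := 0) (u := x i) hh le_rfl
    exact ⟨n, x, fun i => (hn i).1, by simp, by simp, by simp⟩
  | insert j s hj ih =>
    obtain ⟨n, z, h1, h2, h3, h4⟩ := ih
    obtain ⟨k, hk1, hk2⟩ := exists_int_rounding (b := b z j) (u := x j) hh (hα j)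
    refine ⟨Function.update n j k, z + ((k : ℝ) * h - x j) • EuclideanSpace.single j 1, ?_, ?_, ?_,
      ?_⟩
    · intro i
      rcases eq_or_ne i j with rfl | hij
      · simpa using hk1
      · simpa [hij] using h1 i
    · intro i hi
      rcases eq_or_ne i j with rfl | hij
      · simp [h3 i hj]
      · have := h2 i ((Finset.mem_insert.1 hi).resolve_left hij)
        simp [hij, this]
    · intro i hi
      rw [Finset.mem_insert, not_or] at hi
      simp [hi.1, h3 i hi.2]
    · rw [hf, Finset.sum_insert hj]
      linarith

theorem sum_abs_le_sqrt_mul_norm (x : Vec d) : ∑ i, |x i| ≤ √d * ‖x‖ := by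
  rw [EuclideanSpace.norm_eq, ← Real.sqrt_mul d.cast_nonneg]
  apply Real.le_sqrt_of_sq_le
  have := sq_sum_le_card_mul_sum_sq (s := Finset.univ) (f := fun i => |x i|)
  simpa using this

/-- The logarithm of the exponential supermartingale in direction `x` associated with the actions
`a` and the noise `e`, for the variance proxy `v`. -/
def logExpMartingale (v : ℝ) (a : ℕ → Vec d) (e : ℕ → ℝ) (t : ℕ) (x : Vec d) : ℝ :=
  ∑ s ∈ Finset.Icc 1 t, ((inner ℝ (a s) x : ℝ) * e s - v / 2 * (inner ℝ (a s) x : ℝ) ^ 2)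

theorem logExpMartingale_eq (v : ℝ) (a : ℕ → Vec d) (e : ℕ → ℝ) (t : ℕ) (x : Vec d) :
    logExpMartingale v a e t x = inner ℝ x (∑ s ∈ Finset.Icc 1 t, e s • a s) -
      v / 2 * (inner ℝ x (designOp a t x) - ‖x‖ ^ 2) := by
  rw [logExpMartingale, Finset.sum_sub_distrib, inner_designOp_self, add_sub_cancel_left,
    Finset.mul_sum, inner_sum]
  congr 1
  refine Finset.sum_congr rfl fun s _ => ?_
  rw [inner_smul_right, real_inner_comm, mul_comm]

theorem logExpMartingale_add_single (v : ℝ) (a : ℕ → Vec d) (e : ℕ → ℝ) (t : ℕ) (x : Vec d)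
    (i : Fin d) (τ : ℝ) :
    logExpMartingale v a e t (x + τ • EuclideanSpace.single i 1) =
      logExpMartingale v a e t x +
        τ * (∑ s ∈ Finset.Icc 1 t, (a s i * e s - v * (inner ℝ (a s) x : ℝ) * a s i)) -
          τ ^ 2 * (v / 2 * ∑ s ∈ Finset.Icc 1 t, a s i ^ 2) := by
  simp only [logExpMartingale, Finset.mul_sum]
  rw [← Finset.sum_add_distrib, ← Finset.sum_sub_distrib]
  refine Finset.sum_congr rfl fun s _ => ?_
  rw [inner_add_right, inner_smul_right, EuclideanSpace.inner_single_right]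
  simp
  ring

/-- If the noise part of the error of the ridge estimator is at least `ε`, the exponential
supermartingale is large at a lattice point which is not too large. -/
theorem exists_lattice_logExpMartingale_ge {a : ℕ → Vec d} {e : ℕ → ℝ} {t : ℕ} (h : d - 1 < d)
    (ha : ∀ s, 1 ≤ s → s ≤ t → ‖a s‖ ≤ 1) {v ε ρ : ℝ} (hv : 0 < v) (hε : 0 < ε) (hρ : 0 < ρ)
    (he : ε ≤ ‖designInv a t (∑ s ∈ Finset.Icc 1 t, e s • a s)‖) :
    ∃ n : Fin d → ℤ, (∀ i, |(n i : ℝ)| ≤ ρ + 1) ∧ ∑ i, |(n i : ℝ)| ≤ √d * ρ + d ∧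
      ε ^ 2 / (2 * v) * (designEig a t ⟨d - 1, h⟩ - t / ρ ^ 2) ≤
        logExpMartingale v a e t (WithLp.toLp 2 fun i => (n i : ℝ) * (ε / (v * ρ))) := by
  set S := ∑ s ∈ Finset.Icc 1 t, e s • a s with hS
  set w := designInv a t S with hw
  have hwpos : 0 < ‖w‖ := hε.trans_le he
  -- For this `x`, `⟨x, S⟩ = (v ‖w‖ / ε) xᵀ Λ x ≥ v xᵀ Λ x`, which is twice the quadratic penalty.
  -- The length `ε / v` does not depend on `‖w‖`, so `ρ` is the radius of `x` in units of the
  -- lattice spacing `η`.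
  set x : Vec d := (ε / (v * ‖w‖)) • w with hx
  have hxn : ‖x‖ = ε / v := by
    rw [hx, norm_smul, Real.norm_of_nonneg (by positivity)]
    field_simp
  set η := ε / (v * ρ) with hη
  have hη0 : 0 < η := by positivity
  obtain ⟨n, hn1, hn2⟩ := exists_lattice_rounding (f := logExpMartingale v a e t)
    (fun i => by positivity) (logExpMartingale_add_single v a e t) hη0 x
  have hxη : ‖x‖ / η = ρ := by
    rw [hxn, hη]
    field_simp
  have habs : ∀ i, |(n i : ℝ)| ≤ |x i| / η + 1 := by
    intro i
    have h1 : |(n i : ℝ) * η| ≤ |x i| + η := by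
      have := abs_sub_abs_le_abs_sub ((n i : ℝ) * η) (x i)
      linarith [hn1 i]
    rw [abs_mul, abs_of_pos hη0] at h1
    rw [div_add_one hη0.ne', le_div_iff₀ hη0]
    exact h1
  refine ⟨n, fun i => (habs i).trans ?_, ?_, le_trans ?_ hn2⟩
  · rw [← hxη]
    have : |x i| ≤ ‖x‖ := by simpa using PiLp.norm_apply_le x i
    gcongr
  · calc ∑ i, |(n i : ℝ)| ≤ ∑ i, (|x i| / η + 1) := Finset.sum_le_sum fun i _ => habs i
      _ = (∑ i, |x i|) / η + d := by simp [Finset.sum_add_distrib, Finset.sum_div]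
      _ ≤ √d * ‖x‖ / η + d := by
        gcongr
        exact sum_abs_le_sqrt_mul_norm x
      _ = _ := by rw [mul_div_assoc, hxη]
  · have hα : ∑ i, v / 2 * ∑ s ∈ Finset.Icc 1 t, a s i ^ 2 ≤ v / 2 * t := by
      rw [← Finset.mul_sum, Finset.sum_comm]
      have : ∑ s ∈ Finset.Icc 1 t, ∑ i, a s i ^ 2 ≤ ∑ s ∈ Finset.Icc 1 t, (1 : ℝ) :=
        Finset.sum_le_sum fun s hs => by
          rw [Finset.mem_Icc] at hs
          rw [← EuclideanSpace.real_norm_sq_eq]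
          exact pow_le_one₀ (norm_nonneg _) (ha s hs.1 hs.2)
      have h2 : ∑ s ∈ Finset.Icc 1 t, ∑ i, a s i ^ 2 ≤ t := by simpa using this
      gcongr
    have hloss : η ^ 2 * ∑ i, v / 2 * ∑ s ∈ Finset.Icc 1 t, a s i ^ 2 ≤
        ε ^ 2 / (2 * v) * (t / ρ ^ 2) := by
      calc _ ≤ η ^ 2 * (v / 2 * t) := by gcongr
        _ = _ := by rw [hη]; field_simp
    have hgain : ε ^ 2 / (2 * v) * designEig a t ⟨d - 1, h⟩ ≤ logExpMartingale v a e t x := by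
      have h1 : (inner ℝ x S : ℝ) = v * ‖w‖ / ε * inner ℝ x (designOp a t x) := by
        have : S = designOp a t w := (designOp_designInv a t S).symm
        have h2 : w = (v * ‖w‖ / ε) • x := by
          rw [hx, smul_smul]
          have : v * ‖w‖ / ε * (ε / (v * ‖w‖)) = 1 := by field_simp
          rw [this, one_smul]
        conv_lhs => rw [this, h2]
        rw [map_smul, inner_smul_right]
      rw [logExpMartingale_eq, ← hS, h1]
      have h3 := le_inner_designOp a t h x
      rw [hxn] at h3
      set g := (inner ℝ x (designOp a t x) : ℝ)
      have hg : 0 ≤ g := (sq_nonneg _).trans (norm_sq_le_inner_designOp a t x)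
      have h4 : v * g ≤ v * ‖w‖ / ε * g := by
        gcongr
        rw [le_div_iff₀ hε]
        gcongr
      have h5 : ε ^ 2 / (2 * v) * designEig a t ⟨d - 1, h⟩ =
          v / 2 * (designEig a t ⟨d - 1, h⟩ * (ε / v) ^ 2) := by field_simp
      have h6 := mul_le_mul_of_nonneg_left h3 (by positivity : 0 ≤ v / 2)
      have h7 : 0 ≤ v / 2 * ‖x‖ ^ 2 := by positivity
      rw [h5]
      linarith
    linarith

end

/-! ### The exponential supermartingale -/

/-- The conditional bound is a comparison of two measures on `m`. This form allows an arbitrary `[0,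
∞]`-valued weight `Z`, with no integrability to check. -/
theorem lintegral_mul_exp_const_le {Ω : Type*} {m m0 : MeasurableSpace Ω} (hm : m ≤ m0)
    {μ : Measure Ω} [IsFiniteMeasure μ] {X : Ω → ℝ} (hX : Measurable X) {c K : ℝ} (hK : 0 ≤ K)
    (hint : Integrable (fun ω => Real.exp (c * X ω)) μ)
    (hle : μ[fun ω => Real.exp (c * X ω) | m] ≤ᵐ[μ] fun _ => K)
    {Z : Ω → ENNReal} (hZ : Measurable[m] Z) :
    ∫⁻ ω, Z ω * ENNReal.ofReal (Real.exp (c * X ω)) ∂μ ≤ ENNReal.ofReal K * ∫⁻ ω, Z ω ∂μ := by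
  have hmeas : Measurable fun ω => ENNReal.ofReal (Real.exp (c * X ω)) := by fun_prop
  have hν : (μ.withDensity fun ω => ENNReal.ofReal (Real.exp (c * X ω))).trim hm ≤
      ENNReal.ofReal K • μ.trim hm := by
    refine Measure.le_iff.2 fun s hs => ?_
    rw [trim_measurableSet_eq hm hs, withDensity_apply _ (hm s hs), Measure.smul_apply,
      trim_measurableSet_eq hm hs, smul_eq_mul,
      ← ofReal_integral_eq_lintegral_ofReal hint.integrableOn
        (Filter.Eventually.of_forall fun _ => (Real.exp_pos _).le),
      ← setIntegral_condExp hm hint hs]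
    have h1 : ∫ ω in s, (μ[fun ω => Real.exp (c * X ω) | m]) ω ∂μ ≤ ∫ _ω in s, K ∂μ :=
      setIntegral_mono_ae integrable_condExp.integrableOn (integrable_const K).integrableOn hle
    refine (ENNReal.ofReal_le_ofReal h1).trans ?_
    rw [setIntegral_const, smul_eq_mul, mul_comm, ENNReal.ofReal_mul hK, ofReal_measureReal]
  calc ∫⁻ ω, Z ω * ENNReal.ofReal (Real.exp (c * X ω)) ∂μ
      = ∫⁻ ω, Z ω ∂(μ.withDensity fun ω => ENNReal.ofReal (Real.exp (c * X ω))) := by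
        rw [lintegral_withDensity_eq_lintegral_mul _ hmeas (hZ.mono hm le_rfl)]
        simp only [Pi.mul_apply, mul_comm]
    _ = ∫⁻ ω, Z ω ∂((μ.withDensity fun ω => ENNReal.ofReal (Real.exp (c * X ω))).trim hm) :=
        (lintegral_trim hm hZ).symm
    _ ≤ ∫⁻ ω, Z ω ∂(ENNReal.ofReal K • μ.trim hm) := lintegral_mono' hν le_rfl
    _ = ENNReal.ofReal K * ∫⁻ ω, Z ω ∂μ := by
        rw [lintegral_smul_measure, lintegral_trim hm hZ, smul_eq_mul]

theorem exists_finite_range_tendsto {Ω : Type*} [MeasurableSpace Ω] {l : Ω → ℝ}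
    (hl : Measurable l) : ∃ F : ℕ → Ω → ℝ, (∀ n, Measurable (F n)) ∧
      (∀ n, (Set.range (F n)).Finite) ∧
      ∀ ω, Filter.Tendsto (fun n => F n ω) Filter.atTop (nhds (l ω)) :=
  ⟨fun n => hl.stronglyMeasurable.approx n, fun _ => SimpleFunc.measurable _,
    fun _ => SimpleFunc.finite_range _, hl.stronglyMeasurable.tendsto_approx⟩

/-- The conditional bound is known only for each fixed coefficient, off a null set depending on it.
It passes to finitely valued `l` by splitting into level sets, then to general `l` by Fatou's lemma.
-/
theorem lintegral_mul_exp_le {Ω : Type*} {m m0 : MeasurableSpace Ω} (hm : m ≤ m0)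
    {μ : Measure Ω} [IsFiniteMeasure μ] {X : Ω → ℝ} (hX : Measurable X) {v : ℝ}
    (hint : ∀ c : ℝ, Integrable (fun ω => Real.exp (c * X ω)) μ)
    (hle : ∀ c : ℝ, μ[fun ω => Real.exp (c * X ω) | m] ≤ᵐ[μ] fun _ => Real.exp (v * c ^ 2 / 2))
    {l : Ω → ℝ} (hl : Measurable[m] l) {Z : Ω → ENNReal} (hZ : Measurable[m] Z) :
    ∫⁻ ω, Z ω * ENNReal.ofReal (Real.exp (l ω * X ω - v / 2 * l ω ^ 2)) ∂μ ≤ ∫⁻ ω, Z ω ∂μ := by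
  have hZ0 : Measurable Z := hZ.mono hm le_rfl
  have hconst : ∀ (c : ℝ) (W : Ω → ENNReal), Measurable[m] W →
      ∫⁻ ω, W ω * ENNReal.ofReal (Real.exp (c * X ω - v / 2 * c ^ 2)) ∂μ ≤ ∫⁻ ω, W ω ∂μ := by
    intro c W hW
    have h1 := lintegral_mul_exp_const_le hm hX (Real.exp_pos _).le (hint c) (hle c)
      (Z := fun ω => W ω * ENNReal.ofReal (Real.exp (-(v * c ^ 2 / 2)))) (hW.mul_const _)
    have h2 : ∀ ω, W ω * ENNReal.ofReal (Real.exp (c * X ω - v / 2 * c ^ 2)) =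
        W ω * ENNReal.ofReal (Real.exp (-(v * c ^ 2 / 2))) *
          ENNReal.ofReal (Real.exp (c * X ω)) := by
      intro ω
      rw [mul_assoc, ← ENNReal.ofReal_mul (Real.exp_pos _).le, ← Real.exp_add]
      congr 3
      ring
    simp only [h2]
    refine h1.trans (le_of_eq ?_)
    rw [lintegral_mul_const _ (hW.mono hm le_rfl), mul_comm, mul_assoc,
      ← ENNReal.ofReal_mul (Real.exp_pos _).le, ← Real.exp_add]
    simp
  have hsimple : ∀ f : Ω → ℝ, Measurable[m] f → (Set.range f).Finite →
      ∫⁻ ω, Z ω * ENNReal.ofReal (Real.exp (f ω * X ω - v / 2 * f ω ^ 2)) ∂μ ≤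
        ∫⁻ ω, Z ω ∂μ := by
    intro f hf hfin
    have hset : ∀ c, MeasurableSet[m] (f ⁻¹' {c}) := fun c => hf (measurableSet_singleton c)
    have hind : ∀ (W : Ω → ℝ → ENNReal) (ω : Ω),
        W ω (f ω) = ∑ c ∈ hfin.toFinset, (f ⁻¹' {c}).indicator (fun ω => W ω c) ω := by
      intro W ω
      rw [Finset.sum_eq_single (f ω)]
      · simp
      · intro c _ hc
        exact Set.indicator_of_notMem (fun h => hc h.symm) _
      · intro h
        exact absurd (hfin.mem_toFinset.2 ⟨ω, rfl⟩) h
    have h1 : ∀ c, Measurable fun ω =>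
        (f ⁻¹' {c}).indicator Z ω * ENNReal.ofReal (Real.exp (c * X ω - v / 2 * c ^ 2)) :=
      fun c => (hZ0.indicator (hm _ (hset c))).mul (by fun_prop)
    calc ∫⁻ ω, Z ω * ENNReal.ofReal (Real.exp (f ω * X ω - v / 2 * f ω ^ 2)) ∂μ
        = ∫⁻ ω, ∑ c ∈ hfin.toFinset, (f ⁻¹' {c}).indicator Z ω *
            ENNReal.ofReal (Real.exp (c * X ω - v / 2 * c ^ 2)) ∂μ := by
          refine lintegral_congr fun ω => ?_
          rw [hind (fun ω c => Z ω * ENNReal.ofReal (Real.exp (c * X ω - v / 2 * c ^ 2)))]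
          refine Finset.sum_congr rfl fun c _ => ?_
          rw [Set.indicator_mul_left]
      _ = ∑ c ∈ hfin.toFinset, ∫⁻ ω, (f ⁻¹' {c}).indicator Z ω *
            ENNReal.ofReal (Real.exp (c * X ω - v / 2 * c ^ 2)) ∂μ :=
          lintegral_finsetSum _ fun c _ => h1 c
      _ ≤ ∑ c ∈ hfin.toFinset, ∫⁻ ω, (f ⁻¹' {c}).indicator Z ω ∂μ :=
          Finset.sum_le_sum fun c _ => hconst c _ (hZ.indicator (hset c))
      _ = ∫⁻ ω, ∑ c ∈ hfin.toFinset, (f ⁻¹' {c}).indicator Z ω ∂μ :=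
          (lintegral_finsetSum _ fun c _ => hZ0.indicator (hm _ (hset c))).symm
      _ = ∫⁻ ω, Z ω ∂μ := lintegral_congr fun ω => (hind (fun ω _ => Z ω) ω).symm
  obtain ⟨F, hFm, hFfin, hF⟩ := @exists_finite_range_tendsto Ω m l hl
  have hlim : ∀ ω, Filter.Tendsto (fun n => Z ω * ENNReal.ofReal
      (Real.exp (F n ω * X ω - v / 2 * F n ω ^ 2))) Filter.atTop
      (nhds (Z ω * ENNReal.ofReal (Real.exp (l ω * X ω - v / 2 * l ω ^ 2)))) := by
    intro ω
    refine ENNReal.Tendsto.const_mul ?_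
      (Or.inl (ENNReal.ofReal_pos.2 (Real.exp_pos _)).ne')
    have h1 := hF ω
    exact ENNReal.tendsto_ofReal ((Real.continuous_exp.tendsto _).comp
      ((h1.mul_const _).sub ((h1.pow 2).const_mul _)))
  calc ∫⁻ ω, Z ω * ENNReal.ofReal (Real.exp (l ω * X ω - v / 2 * l ω ^ 2)) ∂μ
      = ∫⁻ ω, Filter.liminf (fun n => Z ω * ENNReal.ofReal
          (Real.exp (F n ω * X ω - v / 2 * F n ω ^ 2))) Filter.atTop ∂μ :=
        lintegral_congr fun ω => (hlim ω).liminf_eq.symm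
    _ ≤ Filter.liminf (fun n => ∫⁻ ω, Z ω * ENNReal.ofReal
          (Real.exp (F n ω * X ω - v / 2 * F n ω ^ 2)) ∂μ) Filter.atTop := by
        refine lintegral_liminf_le fun n => ?_
        have : Measurable (F n) := (hFm n).mono hm le_rfl
        fun_prop
    _ ≤ ∫⁻ ω, Z ω ∂μ := by
        refine Filter.liminf_le_of_frequently_le' (Filter.Frequently.of_forall fun n => ?_)
        exact hsimple _ (hFm n) (hFfin n)

section history

variable {d : ℕ} {Ω : Type*} {a : ℕ → Ω → Vec d} {r : ℕ → Ω → ℝ}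

theorem measurable_history_action {s t : ℕ} (h1 : 1 ≤ s) (h2 : s ≤ t) :
    Measurable[history a r t] (a s) :=
  (comap_measurable (a s)).mono
    (le_sup_left.trans (le_iSup₂_of_le (f := fun s _ => MeasurableSpace.comap (a s) inferInstance ⊔
      MeasurableSpace.comap (r s) inferInstance) s (Finset.mem_Icc.2 ⟨h1, h2⟩) le_rfl)) le_rfl

theorem measurable_history_reward {s t : ℕ} (h1 : 1 ≤ s) (h2 : s ≤ t) :
    Measurable[history a r t] (r s) :=
  (comap_measurable (r s)).mono
    (le_sup_right.trans (le_iSup₂_of_le (f := fun s _ => MeasurableSpace.comap (a s) inferInstance ⊔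
      MeasurableSpace.comap (r s) inferInstance) s (Finset.mem_Icc.2 ⟨h1, h2⟩) le_rfl)) le_rfl

theorem measurable_history_logExpMartingale (θ : Vec d) (v : ℝ) (t : ℕ) (x : Vec d) :
    Measurable[history a r t] fun ω =>
      logExpMartingale v (fun s => a s ω) (fun s => noise θ a r s ω) t x := by
  simp only [logExpMartingale, noise]
  refine Finset.measurable_sum _ fun s hs => ?_
  rw [Finset.mem_Icc] at hs
  have h1 := measurable_history_action (a := a) (r := r) hs.1 hs.2
  have h2 := measurable_history_reward (a := a) (r := r) hs.1 hs.2
  exact ((h1.inner_const).mul (h2.sub h1.inner_const)).sub ((h1.inner_const.pow_const 2).const_mul _)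

variable [MeasurableSpace Ω] {μ : Measure Ω} {T : ℕ} {β σ : ℝ} {θ : Vec d}

theorem IsLinUCB.history_le (H : IsLinUCB μ T β σ θ a r) {t : ℕ} (ht : t ≤ T) :
    history a r t ≤ ‹MeasurableSpace Ω› :=
  iSup₂_le fun s hs => by
    rw [Finset.mem_Icc] at hs
    exact sup_le (H.measurable_action s hs.1 (hs.2.trans ht)).comap_le
      (H.measurable_reward s hs.1 (hs.2.trans ht)).comap_le

/-- A proxy `v ≥ σ²` is allowed so that it can be taken positive even when `σ = 0`. -/
theorem IsLinUCB.lintegral_exp_logExpMartingale_le [IsProbabilityMeasure μ]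
    (H : IsLinUCB μ T β σ θ a r) {v : ℝ} (hv : σ ^ 2 ≤ v) (x : Vec d) :
    ∀ t ≤ T, ∫⁻ ω, ENNReal.ofReal (Real.exp
      (logExpMartingale v (fun s => a s ω) (fun s => noise θ a r s ω) t x)) ∂μ ≤ 1 := by
  intro t
  induction t with
  | zero => intro _; simp [logExpMartingale]
  | succ t ih =>
    intro ht
    refine le_trans ?_ (ih (by omega))
    have hm := H.history_le (t := t) (by omega)
    have hX : Measurable (noise θ a r (t + 1)) :=
      (H.measurable_reward _ (by omega) ht).sub
        ((H.measurable_action _ (by omega) ht).inner_const)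
    have hpred := H.predictable (t + 1) (by omega) ht
    rw [Nat.add_sub_cancel] at hpred
    have hl : Measurable[history a r t] fun ω => (inner ℝ (a (t + 1) ω) x : ℝ) :=
      hpred.inner_const
    have hZ : Measurable[history a r t] fun ω => ENNReal.ofReal (Real.exp
        (logExpMartingale v (fun s => a s ω) (fun s => noise θ a r s ω) t x)) :=
      ENNReal.measurable_ofReal.comp (Real.measurable_exp.comp
        (measurable_history_logExpMartingale θ v t x))
    have hsub : ∀ c : ℝ, μ[fun ω => Real.exp (c * noise θ a r (t + 1) ω) | history a r t] ≤ᵐ[μ]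
        fun _ => Real.exp (v * c ^ 2 / 2) := by
      intro c
      have h1 := H.noise_subgaussian (t + 1) (by omega) ht c
      rw [Nat.add_sub_cancel] at h1
      filter_upwards [h1] with ω hω
      exact hω.trans (by gcongr)
    have := lintegral_mul_exp_le hm hX (H.noise_integrable (t + 1) (by omega) ht) hsub hl hZ
    refine le_trans (le_of_eq (lintegral_congr fun ω => ?_)) this
    rw [← ENNReal.ofReal_mul (Real.exp_pos _).le, ← Real.exp_add, logExpMartingale,
      Finset.sum_Icc_succ_top (by omega)]
    rfl

end history

/-! ### The union bound over the lattice -/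

theorem sum_exp_neg_mul_abs_le {γ : ℝ} (hγ : 0 < γ) (B : ℕ) :
    ∑ k ∈ Finset.Icc (-(B : ℤ)) B, Real.exp (-(γ * |(k : ℝ)|)) ≤ 2 * (1 + 1 / γ) := by
  have h1 : ∑ k ∈ Finset.Icc (-(B : ℤ)) B, Real.exp (-(γ * |(k : ℝ)|)) ≤
      2 * ∑ k ∈ Finset.range (B + 1), Real.exp (-γ) ^ k := by
    induction B with
    | zero => simp
    | succ B ih =>
      have hset : Finset.Icc (-((B + 1 : ℕ) : ℤ)) ((B + 1 : ℕ) : ℤ) =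
          insert ((B : ℤ) + 1) (insert (-((B : ℤ) + 1)) (Finset.Icc (-(B : ℤ)) B)) := by
        ext k
        simp only [Finset.mem_Icc, Finset.mem_insert]
        push_cast
        omega
      have hB : (0 : ℝ) ≤ (B : ℝ) + 1 := by positivity
      rw [hset, Finset.sum_insert (by simp; omega), Finset.sum_insert (by simp),
        Finset.sum_range_succ _ (B + 1)]
      push_cast
      rw [abs_neg, abs_of_nonneg hB]
      rw [← Real.exp_nat_mul]
      push_cast
      have : -(γ * ((B : ℝ) + 1)) = ((B : ℝ) + 1) * -γ := by ring
      rw [this]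
      linarith
  refine h1.trans ?_
  have hlt : Real.exp (-γ) < 1 := by simpa using hγ
  have h2 : ∑ k ∈ Finset.range (B + 1), Real.exp (-γ) ^ k ≤ (1 - Real.exp (-γ))⁻¹ := by
    rw [← tsum_geometric_of_lt_one (Real.exp_pos _).le hlt]
    exact (summable_geometric_of_lt_one (Real.exp_pos _).le hlt).sum_le_tsum _
      fun _ _ => by positivity
  have h3 : (1 - Real.exp (-γ))⁻¹ ≤ 1 + 1 / γ := by
    have h4 : Real.exp (-γ) ≤ 1 / (1 + γ) := by
      rw [Real.exp_neg, ← one_div]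
      exact one_div_le_one_div_of_le (by positivity) (by linarith [Real.add_one_le_exp γ])
    have h5 : γ / (1 + γ) ≤ 1 - Real.exp (-γ) := by
      have : γ / (1 + γ) = 1 - 1 / (1 + γ) := by field_simp; ring
      linarith
    calc (1 - Real.exp (-γ))⁻¹ ≤ (γ / (1 + γ))⁻¹ := inv_anti₀ (by positivity) h5
      _ = 1 + 1 / γ := by field_simp; ring
  linarith

/-- The weights factor over coordinates, and each factor sums to at most `2 (1 + 1 / γ)`. The union
bound thus costs order `d`, whatever the box size `B`. -/
theorem sum_exp_neg_lattice_le (d : ℕ) {γ : ℝ} (hγ : 0 < γ) (B : ℕ) (L : ℝ) :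
    ∑ n ∈ Fintype.piFinset fun _ : Fin d => Finset.Icc (-(B : ℤ)) B,
      Real.exp (-(L + γ * ∑ i, |(n i : ℝ)| + d * Real.log (2 * (1 + 1 / γ)))) ≤
        Real.exp (-L) := by
  have hZ : 0 < 2 * (1 + 1 / γ) := by positivity
  have h1 : ∀ n : Fin d → ℤ,
      Real.exp (-(L + γ * ∑ i, |(n i : ℝ)| + d * Real.log (2 * (1 + 1 / γ)))) =
        Real.exp (-L) * ((2 * (1 + 1 / γ)) ^ d)⁻¹ * ∏ i, Real.exp (-(γ * |(n i : ℝ)|)) := by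
    intro n
    rw [← Real.exp_sum, ← Real.exp_log (pow_pos hZ d), ← Real.exp_neg, ← Real.exp_add,
      ← Real.exp_add, Real.log_pow, Finset.sum_neg_distrib, ← Finset.mul_sum]
    congr 1
    ring
  simp only [h1]
  rw [← Finset.mul_sum, ← Finset.prod_univ_sum (fun _ : Fin d => Finset.Icc (-(B : ℤ)) B)
    fun _ k => Real.exp (-(γ * |(k : ℝ)|)), mul_assoc]
  refine mul_le_of_le_one_right (Real.exp_pos _).le ?_
  rw [inv_mul_le_one₀ (pow_pos hZ d)]
  calc _ ≤ ∏ _i : Fin d, 2 * (1 + 1 / γ) := Finset.prod_le_prod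
        (fun _ _ => Finset.sum_nonneg fun _ _ => (Real.exp_pos _).le)
        fun _ _ => sum_exp_neg_mul_abs_le hγ B
    _ = _ := by simp

theorem measure_le_exp_neg {Ω : Type*} [MeasurableSpace Ω] {μ : Measure Ω} {f : Ω → ℝ}
    (hf : Measurable f) (h : ∫⁻ ω, ENNReal.ofReal (Real.exp (f ω)) ∂μ ≤ 1) (c : ℝ) :
    μ {ω | c ≤ f ω} ≤ ENNReal.ofReal (Real.exp (-c)) := by
  have h1 := mul_meas_ge_le_lintegral (μ := μ)
    (f := fun ω => ENNReal.ofReal (Real.exp (f ω))) (by fun_prop)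
    (ENNReal.ofReal (Real.exp c))
  have h2 : {ω | ENNReal.ofReal (Real.exp c) ≤ ENNReal.ofReal (Real.exp (f ω))} =
      {ω | c ≤ f ω} := by
    ext ω
    simp [ENNReal.ofReal_le_ofReal_iff (Real.exp_pos _).le]
  rw [h2] at h1
  rw [Real.exp_neg, ENNReal.ofReal_inv_of_pos (Real.exp_pos _)]
  rw [ENNReal.le_inv_iff_mul_le, mul_comm]
  exact h1.trans h

/-- With high probability the exponential supermartingales at all lattice points are small in all
rounds. -/
theorem IsLinUCB.exists_good_event {d : ℕ} {Ω : Type*} [MeasurableSpace Ω] {μ : Measure Ω}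
    [IsProbabilityMeasure μ] {T : ℕ} {β σ : ℝ} {θ : Vec d} {a : ℕ → Ω → Vec d} {r : ℕ → Ω → ℝ}
    (H : IsLinUCB μ T β σ θ a r) (hT : 1 ≤ T) {v η γ : ℝ} (hv : σ ^ 2 ≤ v) (hγ : 0 < γ) (B : ℕ) :
    ∃ G : Set Ω, 1 - 1 / (T : ℝ) < μ.real G ∧ ∀ ω ∈ G, ∀ t, 1 ≤ t → t ≤ T →
      ∀ n : Fin d → ℤ, (∀ i, |n i| ≤ B) →
        logExpMartingale v (fun s => a s ω) (fun s => noise θ a r s ω) t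
            (WithLp.toLp 2 fun i => (n i : ℝ) * η) <
          Real.log 2 + 2 * Real.log T + γ * ∑ i, |(n i : ℝ)| +
            d * Real.log (2 * (1 + 1 / γ)) := by
  -- Each round fails with probability at most `exp (-L) = 1 / (2 T²)`. The total is `1 / (2 T)`,
  -- and the factor 2 makes the final inequality strict.
  set L := Real.log 2 + 2 * Real.log T with hL
  have hT0 : (0 : ℝ) < T := by exact_mod_cast hT
  set P := Fintype.piFinset fun _ : Fin d => Finset.Icc (-(B : ℤ)) B with hP
  set thr : (Fin d → ℤ) → ℝ := fun n =>
    L + γ * ∑ i, |(n i : ℝ)| + d * Real.log (2 * (1 + 1 / γ)) with hthr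
  set M : ℕ → (Fin d → ℤ) → Ω → ℝ := fun t n ω =>
    logExpMartingale v (fun s => a s ω) (fun s => noise θ a r s ω) t
      (WithLp.toLp 2 fun i => (n i : ℝ) * η) with hM
  have hMm : ∀ t ≤ T, ∀ n, Measurable (M t n) := fun t ht n =>
    (measurable_history_logExpMartingale θ v t _).mono (H.history_le ht) le_rfl
  set bad : Set Ω := ⋃ t ∈ Finset.Icc 1 T, ⋃ n ∈ P, {ω | thr n ≤ M t n ω} with hbad
  have hbadm : MeasurableSet bad := by
    refine Finset.measurableSet_biUnion _ fun t ht => Finset.measurableSet_biUnion _ fun n _ => ?_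
    exact measurableSet_le measurable_const (hMm t (Finset.mem_Icc.1 ht).2 n)
  have hexpL : T * Real.exp (-L) = 1 / (2 * T) := by
    have : Real.exp (-L) = (2 * (T : ℝ) ^ 2)⁻¹ := by
      rw [hL, Real.exp_neg, Real.exp_add, Real.exp_log two_pos, two_mul (Real.log T), Real.exp_add,
        Real.exp_log hT0, sq]
    rw [this]
    field_simp
  have hmeas : μ bad ≤ ENNReal.ofReal (1 / (2 * T)) := by
    calc μ bad ≤ ∑ t ∈ Finset.Icc 1 T, μ (⋃ n ∈ P, {ω | thr n ≤ M t n ω}) :=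
          measure_biUnion_finset_le _ _
      _ ≤ ∑ t ∈ Finset.Icc 1 T, ENNReal.ofReal (Real.exp (-L)) := by
          refine Finset.sum_le_sum fun t ht => (measure_biUnion_finset_le _ _).trans ?_
          have htT := (Finset.mem_Icc.1 ht).2
          calc ∑ n ∈ P, μ {ω | thr n ≤ M t n ω} ≤
                ∑ n ∈ P, ENNReal.ofReal (Real.exp (-thr n)) :=
                Finset.sum_le_sum fun n _ => measure_le_exp_neg (hMm t htT n)
                  (H.lintegral_exp_logExpMartingale_le hv _ t htT) _
            _ = ENNReal.ofReal (∑ n ∈ P, Real.exp (-thr n)) :=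
                (ENNReal.ofReal_sum_of_nonneg fun _ _ => (Real.exp_pos _).le).symm
            _ ≤ _ := ENNReal.ofReal_le_ofReal (sum_exp_neg_lattice_le d hγ B L)
      _ = ENNReal.ofReal (1 / (2 * T)) := by
          rw [Finset.sum_const, Nat.card_Icc, Nat.add_sub_cancel, nsmul_eq_mul,
            ← ENNReal.ofReal_natCast, ← ENNReal.ofReal_mul T.cast_nonneg, hexpL]
  refine ⟨badᶜ, ?_, ?_⟩
  · rw [probReal_compl_eq_one_sub hbadm]
    have h1 : μ.real bad ≤ 1 / (2 * T) := ENNReal.toReal_le_of_le_ofReal (by positivity) hmeas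
    have h2 : 1 / (2 * T : ℝ) < 1 / T := one_div_lt_one_div_of_lt hT0 (by linarith)
    linarith
  · intro ω hω t h1 h2 n hn
    by_contra hcon
    rw [not_lt] at hcon
    refine hω (Set.mem_iUnion₂.2 ⟨t, Finset.mem_Icc.2 ⟨h1, h2⟩, Set.mem_iUnion₂.2 ⟨n, ?_, hcon⟩⟩)
    exact Fintype.mem_piFinset.2 fun i => Finset.mem_Icc.2 (abs_le.1 (hn i))

/-! ### The proposition -/

section run

variable {d : ℕ} {Ω : Type*} [MeasurableSpace Ω] {μ : Measure Ω} {T : ℕ} {β σ : ℝ} {θ : Vec d}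
  {a : ℕ → Ω → Vec d} {r : ℕ → Ω → ℝ}

theorem IsLinUCB.designEig_last_le (H : IsLinUCB μ T β σ θ a r) (h : d - 1 < d) (ω : Ω) {t : ℕ}
    (ht : t ≤ T) : designEig (fun s => a s ω) t ⟨d - 1, h⟩ ≤ 1 + t / d := by
  have hd : (0 : ℝ) < d := by exact_mod_cast (by omega : 0 < d)
  have h1 := sum_designEig_le (a := fun s => a s ω) (t := t)
    fun s h1 h2 => H.action_mem s h1 (h2.trans ht) ω
  have h2 : ∑ _i : Fin d, designEig (fun s => a s ω) t ⟨d - 1, h⟩ ≤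
      ∑ i, designEig (fun s => a s ω) t i :=
    Finset.sum_le_sum fun i _ => designEig_antitone _ t (Fin.le_def.2 (by simp; omega))
  rw [Finset.sum_const, Finset.card_univ, Fintype.card_fin, nsmul_eq_mul] at h2
  rw [← div_self hd.ne', ← add_div, le_div_iff₀ hd]
  linarith

theorem IsLinUCB.le_mul_designEig_last (H : IsLinUCB μ T β σ θ a r) (h : d - 1 < d) (hβ : 0 < β)
    {R : ℝ} (hR : 1 ≤ R) (ω : Ω) {t : ℕ} (ht : t ≤ T)
    (hlam : designEig (fun s => a s ω) t ⟨d - 1, h⟩ ≤ R * β ^ 2) :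
    (t : ℝ) ≤ 3072 * R ^ 2 * (d * designEig (fun s => a s ω) t ⟨d - 1, h⟩) := by
  refine le_mul_designEig_of_ucb h hβ hR (fun s hs => ⟨H.action_mem _ (by omega) (by omega) ω, ?_⟩)
    hlam
  obtain ⟨y, hy, hmax⟩ := H.action_max (s + 1) (by omega) (by omega) ω
  exact ⟨y, hy.2, hmax⟩

/-- On the good event the ridge estimator is accurate once the smallest eigenvalue exceeds
`R β²`. -/
theorem norm_ridge_sub_le_of_good {a : ℕ → Vec d} {r : ℕ → ℝ} {t : ℕ} (hd : 2 ≤ d) (h : d - 1 < d)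
    {κ R : ℝ} (hκ : 0 < κ) (hκβ : κ ≤ β) (hR : 1 ≤ R) (hRκ : 100 ≤ R * κ ^ 2)
    (hRlog : 2 + Real.log (4 + 2000 * R) ≤ 9 / 40000 * (R * κ ^ 2))
    (hθ : ‖θ‖ = 1) (ha : ∀ s, 1 ≤ s → s ≤ t → ‖a s‖ ≤ 1)
    (hlam : R * β ^ 2 ≤ designEig a t ⟨d - 1, h⟩)
    (ht : (t : ℝ) ≤ 307200 * R ^ 3 * β ^ 2 * d) {v η : ℝ}
    (hv : v = β ^ 2 / (κ ^ 2 * (d + Real.log T)))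
    (hη : η = 3 / 100 / (v * (1000 * R * √d)))
    (hgood : ∀ n : Fin d → ℤ, (∀ i, |n i| ≤ (⌈1000 * R * √d + 1⌉₊ : ℕ)) →
      logExpMartingale v a (fun s => r s - inner ℝ (a s) θ) t
          (WithLp.toLp 2 fun i => (n i : ℝ) * η) <
        Real.log 2 + 2 * Real.log T + 1 / (1 + 1000 * R) * ∑ i, |(n i : ℝ)| +
          d * Real.log (2 * (1 + 1 / (1 / (1 + 1000 * R))))) :
    ‖ridge a r t - θ‖ ≤ 4 / 100 := by
  have hβ : 0 < β := hκ.trans_le hκβ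
  have hd0 : (2 : ℝ) ≤ d := by exact_mod_cast hd
  have hlogT : 0 ≤ Real.log T := Real.log_natCast_nonneg T
  have hv0 : 0 < v := by rw [hv]; positivity
  have hκβ2 : κ ^ 2 ≤ β ^ 2 := pow_le_pow_left₀ hκ.le hκβ 2
  have hlpos : 0 < designEig a t ⟨d - 1, h⟩ := one_pos.trans_le (one_le_designEig a t _)
  have hbias : 1 / designEig a t ⟨d - 1, h⟩ ≤ 1 / 100 :=
    one_div_le_one_div_of_le (by norm_num) (by nlinarith)
  suffices hw : ‖designInv a t (∑ s ∈ Finset.Icc 1 t, (r s - inner ℝ (a s) θ) • a s)‖ ≤ 3 / 100 by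
    have := norm_ridge_sub_le (a := a) (r := r) (t := t) h hθ
    linarith
  by_contra hcon
  rw [not_le] at hcon
  have hρ : 0 < 1000 * R * √d := by positivity
  obtain ⟨n, hn1, hn2, hn3⟩ := exists_lattice_logExpMartingale_ge h ha hv0
    (by norm_num : (0 : ℝ) < 3 / 100) hρ hcon.le
  rw [← hη] at hn3
  have hlt := hn3.trans_lt (hgood n fun i => by
    have h1 := (hn1 i).trans (Nat.le_ceil _)
    exact_mod_cast h1)
  -- With `ρ = 1000 R √d` the indices have `ℓ¹`-norm at most `(1 + 1000 R) d`, and `γ` is the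
  -- reciprocal of `1 + 1000 R`.
  have hγ : 1 / (1 + 1000 * R) * ∑ i, |(n i : ℝ)| ≤ d := by
    rw [one_div_mul_eq_div, div_le_iff₀ (by positivity)]
    refine hn2.trans (le_of_eq ?_)
    have := Real.mul_self_sqrt (by positivity : (0 : ℝ) ≤ d)
    linear_combination 1000 * R * this
  have hZ : 2 * (1 + 1 / (1 / (1 + 1000 * R))) = 4 + 2000 * R := by
    rw [one_div_one_div]
    ring
  rw [hZ] at hlt
  set l := designEig a t ⟨d - 1, h⟩ with hl
  have hloss : (t : ℝ) / (1000 * R * √d) ^ 2 ≤ l / 2 := by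
    rw [div_le_iff₀ (by positivity), mul_pow, mul_pow, Real.sq_sqrt (by positivity)]
    have h1 : R * β ^ 2 * (500000 * R ^ 2 * d) ≤ l * (500000 * R ^ 2 * d) := by gcongr
    have h2 : 0 ≤ R ^ 3 * β ^ 2 * d := by positivity
    nlinarith
  -- Rounding loses at most half of `λ ≥ R β²`. The choice of `v` then turns the gain into a
  -- multiple of `d + log T`, the scale of the threshold; `hRlog` makes that multiple large enough.
  have hgain : 9 / 40000 * (R * κ ^ 2) * (d + Real.log T) ≤
      (3 / 100) ^ 2 / (2 * v) * (l - t / (1000 * R * √d) ^ 2) := by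
    have h1 : (3 / 100) ^ 2 / (2 * v) * (R * β ^ 2 / 2) =
        9 / 40000 * (R * κ ^ 2) * (d + Real.log T) := by
      rw [hv]
      field_simp
      norm_num
    rw [← h1]
    gcongr
    linarith
  have hlog2 : Real.log 2 ≤ d := by
    have := Real.log_two_lt_d9
    linarith
  have hlog0 : 0 ≤ Real.log (4 + 2000 * R) := Real.log_nonneg (by linarith)
  have hfin := mul_le_mul_of_nonneg_right hRlog (by linarith : 0 ≤ (d : ℝ) + Real.log T)
  nlinarith [mul_nonneg hlog0 hlogT]

/-- When the estimate is accurate and the smallest eigenvalue exceeds `R β²`, LinUCB plays an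
action close to the parameter. -/
theorem IsLinUCB.inner_action_ge (H : IsLinUCB μ T β σ θ a r) (h : d - 1 < d) (hβ : 0 < β) {R : ℝ}
    (hR : 10000 ≤ R) (ω : Ω) {t : ℕ} (ht : t + 1 ≤ T)
    (hlam : R * β ^ 2 ≤ designEig (fun s => a s ω) t ⟨d - 1, h⟩)
    (hest : ‖ridge (fun s => a s ω) (fun s => r s ω) t - θ‖ ≤ 4 / 100) :
    9 / 10 ≤ (inner ℝ (a (t + 1) ω) θ : ℝ) := by
  obtain ⟨y, hy, hmax⟩ := H.action_max (t + 1) (by omega) ht ω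
  rw [Nat.add_sub_cancel] at hy hmax
  obtain ⟨hy1, hy2⟩ := norm_sphereProj_sub_le H.norm_theta (by linarith) hy
  have ha := H.action_mem (t + 1) (by omega) ht ω
  -- The action has inner product at least `1 - 1/100` with `y`, and `‖y - θ‖ ≤ 8/100`, which leaves
  -- `0.91`.
  have h1 := inner_ge_of_ucb h hβ (by linarith) hlam hy1 ha hmax
  have h2 : 1 / √R ≤ 1 / 100 := by
    refine one_div_le_one_div_of_le (by norm_num) (Real.le_sqrt_of_sq_le ?_)
    norm_num
    exact hR
  have h3 : (inner ℝ (a (t + 1) ω) (y - θ) : ℝ) ≤ ‖y - θ‖ :=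
    (real_inner_le_norm _ _).trans (mul_le_of_le_one_left (norm_nonneg _) ha)
  rw [inner_sub_right] at h3
  linarith

end run

theorem exists_exploration_constant {κ : ℝ} (hκ : 0 < κ) :
    ∃ R : ℝ, 10000 ≤ R ∧ 100 ≤ R * κ ^ 2 ∧
      2 + Real.log (4 + 2000 * R) ≤ 9 / 40000 * (R * κ ^ 2) := by
  set A := 9 / 40000 * κ ^ 2 with hA
  have hA0 : 0 < A := by positivity
  -- The tangent bound for `log` at `η (4 + 2000 R)` then has slope `A / 2` in `R`, half of what is
  -- available.
  set η := A / 4000 with hη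
  have hη0 : 0 < η := by positivity
  refine ⟨max 10000 (max (100 / κ ^ 2) (2 * (1 + 4 * η - Real.log η) / A)), le_max_left _ _,
    ?_, ?_⟩
  · rw [← div_le_iff₀ (by positivity)]
    exact (le_max_left _ _).trans (le_max_right _ _)
  · set R := max 10000 (max (100 / κ ^ 2) (2 * (1 + 4 * η - Real.log η) / A))
    have hR0 : (10000 : ℝ) ≤ R := le_max_left _ _
    have h1 : 2 * (1 + 4 * η - Real.log η) ≤ R * A :=
      (div_le_iff₀ hA0).1 ((le_max_right _ _).trans (le_max_right _ _))
    have h2 := Real.log_le_sub_one_of_pos (by positivity : 0 < η * (4 + 2000 * R))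
    rw [Real.log_mul hη0.ne' (by positivity)] at h2
    have h3 : η * (4 + 2000 * R) = 4 * η + R * A / 2 := by rw [hη]; ring
    have h4 : 9 / 40000 * (R * κ ^ 2) = R * A := by rw [hA]; ring
    linarith

theorem proposition1 (κ : ℝ) (hκ : 0 < κ) :
    ∃ c C : ℝ, 0 < c ∧ 0 < C ∧
      ∀ (d : ℕ) (hd : 2 ≤ d) (β : ℝ), κ ≤ β →
        ∃ t₁ : ℕ, c * (β ^ 2 * d) ≤ t₁ ∧ (t₁ : ℝ) ≤ C * (β ^ 2 * d) ∧
          ∀ (Ω : Type*) [MeasurableSpace Ω] (μ : Measure Ω) [IsProbabilityMeasure μ]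
            (T : ℕ) (σ : ℝ) (θ : Vec d) (a : ℕ → Ω → Vec d) (r : ℕ → Ω → ℝ),
            IsLinUCB μ T β σ θ a r →
              (∀ ω : Ω, ∀ t : ℕ, t ≤ t₁ → t ≤ T →
                c * max 1 ((t : ℝ) / d) ≤ designEig (fun s => a s ω) t ⟨d - 1, by omega⟩ ∧
                designEig (fun s => a s ω) t ⟨d - 1, by omega⟩ ≤ C * max 1 ((t : ℝ) / d)) ∧
              (t₁ ≤ T → κ * (σ * √(d + Real.log T)) ≤ β →
                1 - 1 / (T : ℝ) < μ.real {ω | c * t₁ ≤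
                  designEig (fun s => a s ω) t₁ ⟨0, by omega⟩ -
                    designEig (fun s => a s ω) t₁ ⟨1, by omega⟩}) := by
  obtain ⟨R, hR, hRκ, hRlog⟩ := exists_exploration_constant hκ
  have hR1 : 1 ≤ R := by linarith
  have hRsq : 1 ≤ R ^ 2 := one_le_pow₀ hR1
  have hRcube : 1 ≤ R ^ 3 := one_le_pow₀ hR1
  have hc0 : 0 < 1 / (614400 * R ^ 2) := by positivity
  have hc1 : 1 / (614400 * R ^ 2) ≤ 1 / 2 :=
    one_div_le_one_div_of_le (by norm_num) (by linarith)
  -- Here `614400 = 200 · 3072`: with `x = 3072 R³ β² d ≥ 1` below, `t₁ = ⌈100 x⌉ ≤ 200 x`.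
  refine ⟨1 / (614400 * R ^ 2), 614400 * R ^ 3, hc0, by positivity, ?_⟩
  intro d hd β hκβ
  have hβ : 0 < β := hκ.trans_le hκβ
  have hd0 : (2 : ℝ) ≤ d := by exact_mod_cast hd
  have hlast : d - 1 < d := by omega
  have hκβ2 : κ ^ 2 ≤ β ^ 2 := pow_le_pow_left₀ hκ.le hκβ 2
  set x : ℝ := 3072 * R ^ 3 * (β ^ 2 * d) with hx
  have hx1 : 1 ≤ x := by
    have h1 : 100 ≤ R * β ^ 2 := hRκ.trans (by gcongr)
    have h2 : x = 3072 * R ^ 2 * (R * β ^ 2) * d := by rw [hx]; ring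
    rw [h2]
    have h3 : (1 : ℝ) ≤ 3072 * R ^ 2 := by linarith
    have h4 : (1 : ℝ) ≤ 3072 * R ^ 2 * (R * β ^ 2) :=
      one_le_mul_of_one_le_of_one_le h3 (by linarith)
    exact one_le_mul_of_one_le_of_one_le h4 (by linarith)
  have hx0 : 0 ≤ 100 * x := by linarith
  have ht1 := Nat.le_ceil (100 * x)
  have ht2 := Nat.ceil_lt_add_one hx0
  set t₁ := ⌈100 * x⌉₊ with ht₁
  have hy0 : 0 ≤ β ^ 2 * (d : ℝ) := by positivity
  refine ⟨t₁, ?_, by linarith, ?_⟩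
  · have h1 : 1 / (614400 * R ^ 2) * (β ^ 2 * d) ≤ 3072 * R ^ 3 * (β ^ 2 * d) := by
      gcongr
      linarith
    linarith
  intro Ω _ μ _ T σ θ a r H
  have hgrow : ∀ ω : Ω, ∀ t : ℕ, t ≤ T → x < t →
      R * β ^ 2 ≤ designEig (fun s => a s ω) t ⟨d - 1, hlast⟩ := by
    intro ω t htT hxt
    by_contra hcon
    rw [not_le] at hcon
    have h1 := H.le_mul_designEig_last hlast hβ hR1 ω htT hcon.le
    have h2 : 3072 * R ^ 2 * (d * designEig (fun s => a s ω) t ⟨d - 1, hlast⟩) ≤ x := by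
      calc _ ≤ 3072 * R ^ 2 * (d * (R * β ^ 2)) := by gcongr
        _ = x := by rw [hx]; ring
    linarith
  refine ⟨fun ω t htt htT => ⟨?_, ?_⟩, fun htT hσ => ?_⟩
  · have hl1 := one_le_designEig (fun s => a s ω) t ⟨d - 1, hlast⟩
    rw [one_div_mul_eq_div, div_le_iff₀ (by positivity)]
    refine max_le (one_le_mul_of_one_le_of_one_le hl1 (by linarith)) ?_
    rw [div_le_iff₀ (by linarith)]
    rcases le_total (designEig (fun s => a s ω) t ⟨d - 1, hlast⟩) (R * β ^ 2) with hl | hl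
    · have h1 := H.le_mul_designEig_last hlast hβ hR1 ω htT hl
      have h2 : 0 ≤ R ^ 2 * (d * designEig (fun s => a s ω) t ⟨d - 1, hlast⟩) := by positivity
      linarith
    -- Past the level `R β²` no further growth is needed, because `t ≤ t₁ ≤ 200 x` is itself of
    -- order `d R β²`.
    · have h1 : (t : ℝ) ≤ t₁ := by exact_mod_cast htt
      have h2 : R * β ^ 2 * (614400 * R ^ 2) * d ≤
          designEig (fun s => a s ω) t ⟨d - 1, hlast⟩ * (614400 * R ^ 2) * d := by gcongr
      have h3 : R * β ^ 2 * (614400 * R ^ 2) * d = 200 * x := by rw [hx]; ring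
      linarith
  · have h1 := H.designEig_last_le hlast ω htT
    have h2 := le_max_left 1 ((t : ℝ) / d)
    have h3 := le_max_right 1 ((t : ℝ) / d)
    have h4 : 2 * max 1 ((t : ℝ) / d) ≤ 614400 * R ^ 3 * max 1 ((t : ℝ) / d) := by
      gcongr
      linarith
    linarith
  · have hT1 : 1 ≤ T := by
      have : (1 : ℝ) ≤ t₁ := by linarith
      have : 1 ≤ t₁ := by exact_mod_cast this
      omega
    have hlogT : 0 ≤ Real.log T := Real.log_natCast_nonneg T
    -- The largest variance compatible with the condition on `β`.
    set v := β ^ 2 / (κ ^ 2 * (d + Real.log T)) with hv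
    have hσv : σ ^ 2 ≤ v := by
      rw [hv, le_div_iff₀ (by positivity)]
      have h1 := pow_le_pow_left₀ (by have := H.sigma_nonneg; positivity) hσ 2
      rw [mul_pow, mul_pow, Real.sq_sqrt (by positivity)] at h1
      linarith
    obtain ⟨G, hG, hgood⟩ := H.exists_good_event hT1 (v := v)
      (η := 3 / 100 / (v * (1000 * R * √d))) (γ := 1 / (1 + 1000 * R)) hσv (by positivity)
      ⌈1000 * R * √d + 1⌉₊
    refine hG.trans_le (measureReal_mono fun ω hω => ?_)
    -- Action `t + 1` uses `Λ_t`, so alignment starts only after round `⌊x⌋ + 1`, where `t > x`.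
    have hn : ((⌊x⌋₊ + 1 : ℕ) : ℝ) ≤ t₁ / 20 := by
      have := Nat.floor_le (by linarith : 0 ≤ x)
      push_cast
      linarith
    have hgap := half_le_designEig_sub (a := fun s => a s ω) (⟨0, by omega⟩ : Fin d)
      ⟨1, by omega⟩ rfl rfl H.norm_theta hn
      (fun s h1 h2 => H.action_mem s h1 (h2.trans htT) ω) (fun s h1 h2 => ?_)
    · have ht0 : (0 : ℝ) ≤ t₁ := t₁.cast_nonneg
      have : 1 / (614400 * R ^ 2) * t₁ ≤ 1 / 2 * t₁ := by gcongr
      exact this.trans (by linarith)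
    · obtain ⟨t, rfl⟩ : ∃ t, s = t + 1 := ⟨s - 1, by omega⟩
      have hxt : x < t := Nat.lt_of_floor_lt (by omega)
      have hlam := hgrow ω t (by omega) hxt
      refine H.inner_action_ge hlast hβ hR ω (by omega) hlam ?_
      refine norm_ridge_sub_le_of_good hd hlast hκ hκβ hR1 hRκ hRlog H.norm_theta
        (fun s h1 h2 => H.action_mem s h1 (by omega) ω) hlam ?_ hv rfl
        (hgood ω hω t (by omega) (by omega))
      have h3 : (t : ℝ) ≤ 100 * x := (Nat.lt_ceil.1 (by omega)).le
      rw [hx] at h3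
      linarith
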